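/- \textbf{Setting.} Let $\tau>0$ and let $B\colon[0,\tau]\to\mathbf R$ be continuous with $B(0)=0$, $B(\tau)=1$ and $|B(t)|<1$ for $0\le t<\tau$ (for example a path of a Brownian motion started from $0$, conditioned to hit $1$ before $-1$, and stopped upon hitting $1$). Let $\Gamma=\{(t,B(t)):t\in[0,\tau]\}\subseteq\mathbf R^2$ be its graph. Let $K\in\mathbf N$ and $r,c>0$ with $rK\in\mathbf N$, and put $s=c/2$ and $\mathcal M=\{-3rK,-3rK+1,\dots,K-rK-1\}$. For $n\ge0$ let $T^n_0=0$ and $T^n_{j+1}=\inf\{t>T^n_j:|B(t)-B(T^n_j)|=K^{-n}\}$. A \emph{box at scale $n$} is a rectangle $R=[T^n_j,T^n_{j+1}]\times[\ell K^{-n},(\ell+1)K^{-n}]$ with $T^n_{j+1}\le\tau$, $\ell\in\mathbf Z$, $B(T^n_j)=\ell K^{-n}$ and $B(T^n_{j+1})=(\ell+1)K^{-n}$. Its \emph{children} at height $m\in\mathcal M$ are the boxes at scale $n+1$ with lower boundary at height $\ell K^{-n}+mK^{-(n+1)}$ whose projection to the time axis is contained in $[T^n_j,T^n_{j+1}]$.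 The box $R$ is in $\mathcal G_1$ if for each $m\in\mathcal M$ the restriction of $B$ to $[T^n_j,T^n_{j+1}]$ makes at least $sK$ upcrossings of $[\ell K^{-n}+mK^{-(n+1)},\ell K^{-n}+(m+1)K^{-(n+1)}]$; for $k\ge1$ it is in $\mathcal G_{k+1}$ if for each $m\in\mathcal M$ it has at least $sK$ children at height $m$ that are in $\mathcal G_k$; and $\mathcal G_\infty=\bigcap_{k\ge1}\mathcal G_k$. Let $R_0=[0,\tau]\times[0,1]$ be the box at scale $0$. A \emph{nested family} consists of sets $\mathcal F_n$ of boxes at scale $n$ in $\mathcal G_\infty$, $n\ge0$, with $\mathcal F_0=\{R_0\}$, such that every box in $\mathcal F_{n+1}$ is a child of a box in $\mathcal F_n$, and every box in $\mathcal F_n$ has, at each height $m\in\mathcal M$, at least $sK$ children in $\mathcal F_{n+1}$. Let $\Gamma_n$ be the union, over the boxes in $\mathcal F_n$, of the box together with the rectangle of the same width and of height $3rK^{-n}$ directly below it. For $p\in[1,\infty]$, a compact set $E\subseteq\mathbf R^2$ is \emph{$W^{1,p}$-removable} if every continuous $f\colon\mathbf R^2\to\mathbf R$ with $f\in W^{1,p}(\mathbf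 R^2\setminus E)$ is in $W^{1,p}(\mathbf R^2)$. \textbf{Proposition.} Fix $p\in[1,\infty)$ and suppose that $K>s^{-p}$ and $R_0\in\mathcal G_\infty$. Then the compact set $\Gamma$ is not $W^{1,p}$-removable. Moreover, nested families exist, and for every nested family the set $\bigcap_n\Gamma_n$ is a compact subset of $\Gamma$ that is not $W^{1,p}$-removable. -/

import Mathlib

open MeasureTheory Set
open scoped ContDiff ENNReal

/-! ### Sobolev spaces and removability in the plane -/

/-- `g` is the weak derivative of `f` in the direction `v` on the open set `Ω ⊆ ℝ²`. -/
def HasWeakDerivOn (Ω : Set (ℝ × ℝ)) (v : ℝ × ℝ) (f g : ℝ × ℝ → ℝ) : Prop :=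
  ∀ ψ : ℝ × ℝ → ℝ, ContDiff ℝ ∞ ψ → HasCompactSupport ψ → tsupport ψ ⊆ Ω →
    ∫ z in Ω, f z * fderiv ℝ ψ z v = - ∫ z in Ω, g z * ψ z

/-- `f ∈ W^{1,p}(Ω)`: `f` and its two weak partial derivatives lie in `L^p(Ω)`. -/
def MemW1p (Ω : Set (ℝ × ℝ)) (p : ℝ≥0∞) (f : ℝ × ℝ → ℝ) : Prop :=
  MemLp f p (volume.restrict Ω) ∧
    ∃ gx gy : ℝ × ℝ → ℝ,
      MemLp gx p (volume.restrict Ω) ∧ MemLp gy p (volume.restrict Ω) ∧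
      HasWeakDerivOn Ω (1, 0) f gx ∧ HasWeakDerivOn Ω (0, 1) f gy

/-- The (compact) set `E ⊆ D` is `W^{1,p}`-removable inside the domain `D`. -/
def IsW1pRemovableIn (D : Set (ℝ × ℝ)) (p : ℝ≥0∞) (E : Set (ℝ × ℝ)) : Prop :=
  ∀ f : ℝ × ℝ → ℝ, ContinuousOn f D → MemW1p (D \ E) p f → MemW1p D p f

/-- The (compact) set `E` is `W^{1,p}`-removable, i.e. removable inside the whole plane. -/
def IsW1pRemovable (p : ℝ≥0∞) (E : Set (ℝ × ℝ)) : Prop :=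
  IsW1pRemovableIn univ p E

/-! ### Boxes of a path -/

/-- The graph of `B` over `[0, τ]`. -/
def pathGraph (B : ℝ → ℝ) (τ : ℝ) : Set (ℝ × ℝ) :=
  (fun t => (t, B t)) '' Icc 0 τ

/-- `IsCrossingTime B δ j t` says that `T_j` exists and equals `t`, where `T_0 = 0` and
`T_{j+1}` is the first time after `T_j` at which `|B - B(T_j)| = δ`. -/
inductive IsCrossingTime (B : ℝ → ℝ) (δ : ℝ) : ℕ → ℝ → Prop
  | zero : IsCrossingTime B δ 0 0
  | succ {j : ℕ} {t t' : ℝ} : IsCrossingTime B δ j t →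
      IsLeast {u | t < u ∧ |B u - B t| = δ} t' → IsCrossingTime B δ (j + 1) t'

/-- The data of a box: its left and right boundary, and the integer `ℓ` for which (at scale `n`)
its lower and upper boundary are at heights `ℓ K^{-n}` and `(ℓ + 1) K^{-n}`. -/
@[ext]
structure PathBox where
  left : ℝ
  right : ℝ
  level : ℤ

/-- The height `K^{-n}` of the boxes at scale `n`. -/
noncomputable def mesh (K n : ℕ) : ℝ := ((K : ℝ) ^ n)⁻¹

/-- `R` is a box at scale `n` of the path `B` stopped at `τ`: its sides are two consecutive
crossing times, at most `τ`, between which the path goes from `ℓ K^{-n}` up to `(ℓ+1) K^{-n}`. -/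
def IsBox (B : ℝ → ℝ) (τ : ℝ) (K n : ℕ) (R : PathBox) : Prop :=
  (∃ j : ℕ, IsCrossingTime B (mesh K n) j R.left ∧ IsCrossingTime B (mesh K n) (j + 1) R.right) ∧
    R.right ≤ τ ∧
    B R.left = R.level * mesh K n ∧ B R.right = (R.level + 1) * mesh K n

/-- The set `{-3rK, -3rK + 1, …, K - rK - 1}` of relative heights of children. -/
def childHeights (r : ℝ) (K : ℕ) : Set ℤ :=
  {m | -(3 * r * K) ≤ (m : ℝ) ∧ (m : ℝ) ≤ K - r * K - 1}

/-- `R'` (at scale `n + 1`) is a child of `R` (at scale `n`) at relative height `m`. -/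
def IsChildAt (B : ℝ → ℝ) (τ : ℝ) (K n : ℕ) (R R' : PathBox) (m : ℤ) : Prop :=
  IsBox B τ K (n + 1) R' ∧ R.left ≤ R'.left ∧ R'.right ≤ R.right ∧
    R'.level = R.level * K + m

/-- On the time interval `[t₀, t₁]` the path makes at least `N` upcrossings of `[a, b]`. -/
def HasUpcrossings (B : ℝ → ℝ) (t₀ t₁ a b : ℝ) (N : ℕ) : Prop :=
  ∃ σ ρ : Fin N → ℝ,
    (∀ i, t₀ ≤ σ i ∧ σ i < ρ i ∧ ρ i ≤ t₁ ∧ B (σ i) ≤ a ∧ b ≤ B (ρ i)) ∧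
    ∀ i j, i < j → ρ i ≤ σ j

/-- The box `R` at scale `n` is `(r, c)`-good: there are at least `c K` upcrossings inside `R` of
each interval `[ℓ K^{-n} + m K^{-(n+1)}, ℓ K^{-n} + (m+1) K^{-(n+1)}]`. -/
def IsGoodBox (B : ℝ → ℝ) (τ : ℝ) (K : ℕ) (r c : ℝ) (n : ℕ) (R : PathBox) : Prop :=
  IsBox B τ K n R ∧ ∀ m ∈ childHeights r K, ∃ N : ℕ, c * K ≤ N ∧
    HasUpcrossings B R.left R.right
      (R.level * mesh K n + m * mesh K (n + 1))
      (R.level * mesh K n + (m + 1) * mesh K (n + 1)) N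

/-- `IsNGood B τ K r s k n R`: the box `R` at scale `n` is `k`-good with parameter `s`.
It is meaningful for `k ≥ 1`; the value at `k = 0` is a placeholder that nothing refers to. -/
def IsNGood (B : ℝ → ℝ) (τ : ℝ) (K : ℕ) (r s : ℝ) : ℕ → ℕ → PathBox → Prop
  | 0, n, R => IsBox B τ K n R
  | 1, n, R => IsGoodBox B τ K r s n R
  | k + 2, n, R => IsBox B τ K n R ∧ ∀ m ∈ childHeights r K,
      ∃ S : Finset PathBox, s * K ≤ (S.card : ℝ) ∧
        ∀ R' ∈ S, IsChildAt B τ K n R R' m ∧ IsNGood B τ K r s (k + 1) (n + 1) R'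

/-- The box `R` at scale `n` is `k`-good for every `k ≥ 1`. -/
def IsInftyGood (B : ℝ → ℝ) (τ : ℝ) (K : ℕ) (r s : ℝ) (n : ℕ) (R : PathBox) : Prop :=
  ∀ k : ℕ, 1 ≤ k → IsNGood B τ K r s k n R

/-- The box `[0, τ] × [0, 1]` at scale `0`. -/
def rootBox (τ : ℝ) : PathBox := ⟨0, τ, 0⟩

/-- `F n` is the set of members at scale `n` of an infinite nested family of infinitely good boxes
that starts from the box at scale `0` and in which every member has at least `s K` children
at each of the possible heights. -/
structure IsNestedFamily (B : ℝ → ℝ) (τ : ℝ) (K : ℕ) (r s : ℝ)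
    (F : ℕ → Set PathBox) : Prop where
  root : F 0 = {rootBox τ}
  good : ∀ n, ∀ R ∈ F n, IsInftyGood B τ K r s n R
  nested : ∀ n, ∀ R' ∈ F (n + 1), ∃ R ∈ F n, ∃ m ∈ childHeights r K, IsChildAt B τ K n R R' m
  children : ∀ n, ∀ R ∈ F n, ∀ m ∈ childHeights r K,
    ∃ S : Finset PathBox, s * K ≤ (S.card : ℝ) ∧
      ∀ R' ∈ S, R' ∈ F (n + 1) ∧ IsChildAt B τ K n R R' m

/-- The rectangle of a box at scale `n`, together with the rectangle of the same width and of
height `3 r K^{-n}` directly below it. -/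
def PathBox.extended (r : ℝ) (K n : ℕ) (R : PathBox) : Set (ℝ × ℝ) :=
  Icc R.left R.right ×ˢ Icc ((R.level - 3 * r) * mesh K n) ((R.level + 1) * mesh K n)

/-- The intersection over all scales `n` of the union of the (extended) boxes at scale `n`. -/
def familyLimitSet (r : ℝ) (K : ℕ) (F : ℕ → Set PathBox) : Set (ℝ × ℝ) :=
  ⋂ n : ℕ, ⋃ R ∈ F n, R.extended r K n

/-! To each box `R` attach a function that rises from 0 to 1 from left to right across `R` and, in
the limit, varies horizontally only on the limit set. Start from a smooth ramp (`ladder` at depth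
0). To refine it, cut the heights with a smooth partition of unity and put, at each height, the
average of the functions attached to the selected children there. The overhang of the boxes makes
room for adjacent bumps to overlap and still sum to 1 at all heights where the function of `R` is
used.

The children at one height lie over intervals with disjoint interiors, so over a given point at most
one of them is still changing, while at least `t K` of them share the average, for a suitable `t ≤
s` with `t < 1`. A refinement therefore shrinks the change by a factor `(t K)⁻¹ < 1`, and the stages
converge uniformly (`abs_ladder_succ_sub_le`). Left and right of `R` the function is constant at its
active heights, so derivatives of the bumps matter only over boxes. At scale `n` these are of order
`K ^ n`, and `n` averages multiply them by `(t K)⁻ⁿ`. The vertical derivative is thus of order `t⁻ⁿ`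
on a tube of area of order `K⁻ⁿ` around the graph, and the sum of `t⁻ᵖⁿ K⁻ⁿ` converges because `K >
t⁻ᵖ` (`abs_fderiv_ladder_vertical_le`, `memLp_of_abs_le_geometric`).

Off the limit set the limit function locally equals a finite stage whose horizontal derivative is
zero there. The limit set is null, so if it were removable, the weak horizontal derivative on the
plane would vanish almost everywhere away from the outer cutoff. Yet the function passes from 0 to a
nonzero bump across the root box (`not_isW1pRemovable_of_classical_deriv`,
`not_isW1pRemovable_of_isSelection`). Any closed null set containing the limit set is excluded in
the same way, in particular the graph. -/

/-! ### Integration by parts and a criterion for non-removability. -/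

theorem integral_mul_fderiv_eq_neg_of_tsupport_subset {f ψ : ℝ × ℝ → ℝ} {U : Set (ℝ × ℝ)}
    {v : ℝ × ℝ} (hf : Continuous f) (hdiff : ∀ z ∈ U, DifferentiableAt ℝ f z)
    (hloc : LocallyIntegrable (fun z => fderiv ℝ f z v))
    (hψ : ContDiff ℝ ∞ ψ) (hψc : HasCompactSupport ψ) (hψU : tsupport ψ ⊆ U) :
    ∫ z, f z * fderiv ℝ ψ z v = - ∫ z, fderiv ℝ f z v * ψ z := by
  have hψd : Continuous fun z => fderiv ℝ ψ z v :=
    (hψ.continuous_fderiv (by simp)).clm_apply continuous_const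
  refine integral_mul_fderiv_eq_neg_fderiv_mul_of_integrable ?_ ?_ ?_
    (fun z hz => hdiff z (hψU hz)) (fun z _ => (hψ.differentiable (by simp)) z)
  · exact hloc.integrable_smul_right_of_hasCompactSupport hψ.continuous hψc
  · exact (hf.mul hψd).integrable_of_hasCompactSupport
      ((hψc.fderiv_apply (𝕜 := ℝ) v).mul_left)
  · exact (hf.mul hψ.continuous).integrable_of_hasCompactSupport hψc.mul_left

/-- A continuous, compactly supported function that is smooth off the null closed set `E` with
`p`-integrable partial derivatives, and whose classical horizontal derivative is not its
distributional one, shows that `E` is not removable. -/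
theorem not_isW1pRemovable_of_classical_deriv {p : ℝ≥0∞} (hp : 1 ≤ p) {E : Set (ℝ × ℝ)}
    (hE : IsClosed E) (hE0 : volume E = 0) {f ψ : ℝ × ℝ → ℝ} (hf : Continuous f)
    (hfc : HasCompactSupport f) (hdiff : ∀ z ∉ E, DifferentiableAt ℝ f z)
    (hx : MemLp (fun z => fderiv ℝ f z (1, 0)) p)
    (hy : MemLp (fun z => fderiv ℝ f z (0, 1)) p)
    (hψ : ContDiff ℝ ∞ ψ) (hψc : HasCompactSupport ψ)
    (hzero : ∀ z ∉ E, fderiv ℝ f z (1, 0) * ψ z = 0)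
    (hne : ∫ z, f z * fderiv ℝ ψ z (1, 0) ≠ 0) : ¬ IsW1pRemovable p E := by
  intro hrem
  have hae : (univ \ E : Set (ℝ × ℝ)) =ᵐ[volume] univ := by
    rw [← compl_eq_univ_sdiff]
    exact Filter.eventuallyEq_univ.2 (compl_mem_ae_iff.2 hE0)
  have hrestr : (volume : Measure (ℝ × ℝ)).restrict (univ \ E) = volume := by
    rw [Measure.restrict_congr_set hae, Measure.restrict_univ]
  have hweak : ∀ v : ℝ × ℝ, LocallyIntegrable (fun z => fderiv ℝ f z v) →
      HasWeakDerivOn (univ \ E) v f (fun z => fderiv ℝ f z v) := by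
    intro v hv φ hφ hφc hφs
    rw [hrestr]
    exact integral_mul_fderiv_eq_neg_of_tsupport_subset hf (fun z hz => hdiff z hz.2) hv hφ hφc hφs
  have hW : MemW1p (univ \ E) p f := by
    refine ⟨?_, _, _, ?_, ?_, hweak _ (hx.locallyIntegrable hp), hweak _ (hy.locallyIntegrable hp)⟩
      <;> rw [hrestr]
    exacts [hf.memLp_of_hasCompactSupport hfc, hx, hy]
  obtain ⟨-, gx, -, hgx, -, hwx, -⟩ := hrem f hf.continuousOn hW
  rw [Measure.restrict_univ] at hgx
  have hxl := hx.locallyIntegrable hp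
  have hgl := hgx.locallyIntegrable hp
  have hU : IsOpen (univ \ E) := by
    rw [← compl_eq_univ_sdiff]; exact hE.isOpen_compl
  -- Against test functions supported off `E`, both `gx` and the classical derivative are weak
  -- derivatives of `f`, so they agree almost everywhere there.
  have heq : ∀ᵐ z, z ∈ univ \ E → gx z - fderiv ℝ f z (1, 0) = 0 := by
    refine hU.ae_eq_zero_of_integral_contDiff_smul_eq_zero
      ((hgl.sub hxl).locallyIntegrableOn _) fun φ hφ hφc hφs => ?_
    have h1 := hwx φ hφ hφc (subset_univ _)
    rw [Measure.restrict_univ] at h1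
    have h2 := integral_mul_fderiv_eq_neg_of_tsupport_subset hf (fun z hz => hdiff z hz.2)
      hxl hφ hφc hφs
    rw [h1, neg_inj] at h2
    have e : (fun z => φ z • (gx z - fderiv ℝ f z (1, 0))) =
        fun z => gx z * φ z - fderiv ℝ f z (1, 0) * φ z := by
      ext z; simp only [smul_eq_mul]; ring
    rw [e, integral_sub, h2, sub_self]
    · exact hgl.integrable_smul_right_of_hasCompactSupport hφ.continuous hφc
    · exact hxl.integrable_smul_right_of_hasCompactSupport hφ.continuous hφc
  have h3 := hwx ψ hψ hψc (subset_univ _)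
  rw [Measure.restrict_univ] at h3
  apply hne
  rw [h3, neg_eq_zero]
  refine integral_eq_zero_of_ae ?_
  filter_upwards [heq, (compl_mem_ae_iff.2 hE0 : Eᶜ ∈ ae volume)] with z hz hzE
  simp only [Pi.zero_apply]
  rw [sub_eq_zero.1 (hz ⟨mem_univ z, hzE⟩)]
  exact hzero z hzE

/-! ### Mesh sizes, crossing times and boxes. -/

theorem mesh_pos {K : ℕ} (hK : 0 < K) (n : ℕ) : 0 < mesh K n := by
  unfold mesh; positivity

theorem mul_mesh_succ {K : ℕ} (hK : 0 < K) (n : ℕ) : (K : ℝ) * mesh K (n + 1) = mesh K n := by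
  unfold mesh; field_simp; ring

theorem tendsto_mesh {K : ℕ} (hK : 1 < K) : Filter.Tendsto (mesh K) Filter.atTop (nhds 0) := by
  have h : (mesh K) = fun n => ((K : ℝ)⁻¹) ^ n := by ext n; simp [mesh]
  rw [h]
  exact tendsto_pow_atTop_nhds_zero_of_lt_one (by positivity)
    (inv_lt_one_of_one_lt₀ (by exact_mod_cast hK))

namespace IsCrossingTime

variable {B : ℝ → ℝ} {δ : ℝ} {i j : ℕ} {t t' : ℝ}

theorem unique (h : IsCrossingTime B δ j t) (h' : IsCrossingTime B δ j t') : t = t' := by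
  induction h generalizing t' with
  | zero => cases h'; rfl
  | succ _ hl ih =>
    cases h' with
    | succ h₁ hl' => obtain rfl := ih h₁; exact hl.unique hl'

theorem le_of_le (h : IsCrossingTime B δ i t) (h' : IsCrossingTime B δ j t') (hij : i ≤ j) :
    t ≤ t' := by
  induction h' generalizing i t with
  | zero => obtain rfl := Nat.le_zero.1 hij; exact (h.unique .zero).le
  | succ h₁ hl ih =>
    rcases hij.eq_or_lt with rfl | hlt
    · exact (h.unique (.succ h₁ hl)).le
    · exact (ih h (Nat.lt_succ_iff.1 hlt)).trans hl.1.1.le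

theorem nonneg (h : IsCrossingTime B δ j t) : 0 ≤ t :=
  IsCrossingTime.zero.le_of_le h (Nat.zero_le j)

theorem isLeast_of_succ (h : IsCrossingTime B δ j t) (h' : IsCrossingTime B δ (j + 1) t') :
    IsLeast {u | t < u ∧ |B u - B t| = δ} t' := by
  cases h' with
  | succ h₁ hl => obtain rfl := h.unique h₁; exact hl

/-- Consecutive crossing times before `τ` are at a distance bounded from below. -/
theorem mul_le {τ η : ℝ} (hη : ∀ x ∈ Icc 0 τ, ∀ y ∈ Icc 0 τ, |x - y| < η → |B x - B y| < δ)
    (h : IsCrossingTime B δ j t) (ht : t ≤ τ) : j * η ≤ t := by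
  induction h with
  | zero => simp
  | @succ j t t' h₁ hl ih =>
    have hlt : t < t' := hl.1.1
    have h2 := ih (hlt.le.trans ht)
    have h3 : η ≤ t' - t := by
      by_contra! hcon
      have := hη t' ⟨h₁.nonneg.trans hlt.le, ht⟩ t ⟨h₁.nonneg, hlt.le.trans ht⟩
        (by rwa [abs_of_pos (by linarith)])
      exact absurd hl.1.2 this.ne
    push_cast
    linarith

end IsCrossingTime

namespace IsBox

variable {B : ℝ → ℝ} {τ r : ℝ} {K n : ℕ} {R R' : PathBox}

theorem left_lt_right (h : IsBox B τ K n R) : R.left < R.right := by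
  obtain ⟨⟨j, h1, h2⟩, -⟩ := h
  exact (h1.isLeast_of_succ h2).1.1

theorem left_nonneg (h : IsBox B τ K n R) : 0 ≤ R.left := by
  obtain ⟨⟨j, h1, h2⟩, -⟩ := h
  exact h1.nonneg

theorem eq_of_left_eq (hK : 0 < K) (h : IsBox B τ K n R) (h' : IsBox B τ K n R')
    (hr : R.right = R'.right) (hl : R.left = R'.left) : R = R' := by
  refine PathBox.ext hl hr ?_
  have h1 := h.2.2.1
  rw [hl, h'.2.2.1] at h1
  exact_mod_cast (mul_right_cancel₀ (mesh_pos hK n).ne' h1).symm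

/-- Two boxes at the same scale lie over intervals without common interior points. -/
theorem eq_or_right_le_left (hK : 0 < K) (h : IsBox B τ K n R) (h' : IsBox B τ K n R') :
    R = R' ∨ R.right ≤ R'.left ∨ R'.right ≤ R.left := by
  obtain ⟨i, h1, h2⟩ := h.1
  obtain ⟨j, h3, h4⟩ := h'.1
  rcases lt_trichotomy i j with hij | rfl | hij
  · exact Or.inr (Or.inl (h2.le_of_le h3 hij))
  · exact Or.inl (h.eq_of_left_eq hK h' (h2.unique h4) (h1.unique h3))
  · exact Or.inr (Or.inr (h4.le_of_le h1 hij))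

/-- By the intermediate value theorem, a larger displacement would force an earlier crossing time.
-/
theorem abs_sub_left_le (hB : ContinuousOn B (Icc 0 τ)) (hK : 0 < K) (h : IsBox B τ K n R)
    {t : ℝ} (ht : t ∈ Icc R.left R.right) : |B t - B R.left| ≤ mesh K n := by
  obtain ⟨⟨j, h1, h2⟩, hτ, -⟩ := h
  have hl := h1.isLeast_of_succ h2
  by_contra! hcon
  have hc : ContinuousOn (fun u => |B u - B R.left|) (Icc R.left t) :=
    ((hB.mono (Icc_subset_Icc h1.nonneg (ht.2.trans hτ))).sub continuousOn_const).abs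
  have hmem : mesh K n ∈ Icc (|B R.left - B R.left|) (|B t - B R.left|) := by
    simpa using ⟨(mesh_pos hK n).le, hcon.le⟩
  obtain ⟨u, hu, hue⟩ := intermediate_value_Icc ht.1 hc hmem
  have hue' : |B u - B R.left| = mesh K n := hue
  have hlu : R.left < u := by
    rcases hu.1.eq_or_lt with rfl | h
    · simp only [sub_self, abs_zero] at hue'
      exact absurd hue' (mesh_pos hK n).ne
    · exact h
  have : t = u := le_antisymm (ht.2.trans (hl.2 ⟨hlu, hue'⟩)) hu.2
  subst this
  exact absurd hue' hcon.ne'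

/-- Over the box the path stays within one mesh of the lower boundary; since `3 * r ≤ 1`, so does
the extended rectangle. -/
theorem abs_sub_le_of_mem_extended (hB : ContinuousOn B (Icc 0 τ)) (hK : 0 < K)
    (h : IsBox B τ K n R) (hr : 3 * r ≤ 1) {z : ℝ × ℝ} (hz : z ∈ R.extended r K n) :
    z.1 ∈ Icc 0 τ ∧ |z.2 - B z.1| ≤ 2 * mesh K n := by
  obtain ⟨hz1, hz2, hz3⟩ := hz
  refine ⟨⟨h.left_nonneg.trans hz1.1, hz1.2.trans h.2.1⟩, ?_⟩
  have h1 := h.abs_sub_left_le hB hK hz1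
  rw [h.2.2.1] at h1
  have h2 := mul_le_mul_of_nonneg_right hr (mesh_pos hK n).le
  rw [abs_le] at h1 ⊢
  constructor <;> nlinarith

end IsBox

/-- Uniform continuity bounds the gaps between crossing times from below, hence bounds the index
`j`, and `j` determines the box. -/
theorem finite_setOf_isBox {B : ℝ → ℝ} {τ : ℝ} {K : ℕ} (hB : ContinuousOn B (Icc 0 τ))
    (hK : 0 < K) (n : ℕ) : {R | IsBox B τ K n R}.Finite := by
  have hu := isCompact_Icc.uniformContinuousOn_of_continuous hB
  obtain ⟨η, hη0, hη⟩ := Metric.uniformContinuousOn_iff.1 hu (mesh K n) (mesh_pos hK n)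
  simp only [Real.dist_eq] at hη
  have hfin : (⋃ j ∈ Iic ⌈τ / η⌉₊, {R | IsBox B τ K n R ∧ IsCrossingTime B (mesh K n) j R.left ∧
      IsCrossingTime B (mesh K n) (j + 1) R.right}).Finite := by
    refine (finite_Iic _).biUnion fun j _ => Set.Subsingleton.finite ?_
    rintro R ⟨hR, h1, h2⟩ R' ⟨hR', h3, h4⟩
    exact hR.eq_of_left_eq hK hR' (h2.unique h4) (h1.unique h3)
  refine hfin.subset fun R hR => ?_
  obtain ⟨j, h1, h2⟩ := hR.1
  refine mem_iUnion₂.2 ⟨j, ?_, hR, h1, h2⟩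
  have h3 := h1.mul_le hη (hR.left_lt_right.le.trans hR.2.1)
  have h4 : (j : ℝ) ≤ τ / η := by
    rw [le_div_iff₀ hη0]; exact h3.trans (hR.left_lt_right.le.trans hR.2.1)
  exact_mod_cast h4.trans (Nat.le_ceil _)

/-! ### Good boxes and the existence of nested families. -/

theorem IsNGood.isBox {B : ℝ → ℝ} {τ : ℝ} {K : ℕ} {r s : ℝ} {k n : ℕ} {R : PathBox}
    (h : IsNGood B τ K r s k n R) : IsBox B τ K n R := by
  match k, h with
  | 0, h => exact h
  | 1, h => exact h.1
  | _ + 2, h => exact h.1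

theorem IsInftyGood.isBox {B : ℝ → ℝ} {τ : ℝ} {K : ℕ} {r s : ℝ} {n : ℕ} {R : PathBox}
    (h : IsInftyGood B τ K r s n R) : IsBox B τ K n R := (h 1 le_rfl).isBox

/-- Each child is itself an upcrossing, and sorting the children by left endpoint puts these in
temporal order. This is the base case for monotonicity of goodness. -/
theorem hasUpcrossings_of_children {B : ℝ → ℝ} {τ : ℝ} {K n : ℕ} (hK : 0 < K) {R : PathBox}
    {m : ℤ} {S : Finset PathBox} (hS : ∀ R' ∈ S, IsChildAt B τ K n R R' m) :
    HasUpcrossings B R.left R.right (R.level * mesh K n + m * mesh K (n + 1))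
      (R.level * mesh K n + (m + 1) * mesh K (n + 1)) S.card := by
  classical
  have htri : ∀ R₁ ∈ S, ∀ R₂ ∈ S, R₁.left < R₂.left → R₁.right ≤ R₂.left := by
    intro R₁ h₁ R₂ h₂ hlt
    rcases (hS R₁ h₁).1.eq_or_right_le_left hK (hS R₂ h₂).1 with rfl | h | h
    · exact absurd hlt (lt_irrefl _)
    · exact h
    · linarith [(hS R₂ h₂).1.left_lt_right]
  have hinj : Set.InjOn PathBox.left (S : Set PathBox) := by
    intro R₁ h₁ R₂ h₂ heq
    rcases (hS R₁ h₁).1.eq_or_right_le_left hK (hS R₂ h₂).1 with h | h | h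
    · exact h
    · linarith [(hS R₁ h₁).1.left_lt_right]
    · linarith [(hS R₂ h₂).1.left_lt_right]
  have hcard : (S.image PathBox.left).card = S.card := Finset.card_image_of_injOn hinj
  let e := (S.image PathBox.left).orderEmbOfFin hcard
  have he : ∀ i, ∃ R' ∈ S, R'.left = e i := fun i =>
    Finset.mem_image.1 (Finset.orderEmbOfFin_mem _ hcard i)
  choose f hfS hfe using he
  refine ⟨fun i => (f i).left, fun i => (f i).right, fun i => ?_, fun i j hij => ?_⟩
  · obtain ⟨hbox, hl, hr, hlev⟩ := hS _ (hfS i)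
    refine ⟨hl, hbox.left_lt_right, hr, ?_, ?_⟩
    · rw [hbox.2.2.1, hlev, ← mul_mesh_succ hK n]; push_cast; exact le_of_eq (by ring)
    · rw [hbox.2.2.2, hlev, ← mul_mesh_succ hK n]; push_cast; exact le_of_eq (by ring)
  · refine htri _ (hfS i) _ (hfS j) ?_
    rw [hfe, hfe]
    exact e.strictMono hij

theorem IsNGood.of_succ {B : ℝ → ℝ} {τ : ℝ} {K : ℕ} {r s : ℝ} (hK : 0 < K) {k n : ℕ}
    {R : PathBox} (h : IsNGood B τ K r s (k + 2) n R) : IsNGood B τ K r s (k + 1) n R := by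
  induction k generalizing n R with
  | zero =>
    refine ⟨h.1, fun m hm => ?_⟩
    obtain ⟨S, hc, hS⟩ := h.2 m hm
    exact ⟨S.card, hc, hasUpcrossings_of_children hK fun R' hR' => (hS R' hR').1⟩
  | succ k ih =>
    refine ⟨h.1, fun m hm => ?_⟩
    obtain ⟨S, hc, hS⟩ := h.2 m hm
    exact ⟨S, hc, fun R' hR' => ⟨(hS R' hR').1, ih (hS R' hR').2⟩⟩

theorem IsNGood.of_le {B : ℝ → ℝ} {τ : ℝ} {K : ℕ} {r s : ℝ} (hK : 0 < K) {k k' n : ℕ}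
    {R : PathBox} (hk : 1 ≤ k) (hkk : k ≤ k') (h : IsNGood B τ K r s k' n R) :
    IsNGood B τ K r s k n R := by
  induction k', hkk using Nat.le_induction with
  | base => exact h
  | succ k' hkk' ih =>
    obtain ⟨l, rfl⟩ : ∃ l, k' = l + 1 := ⟨k' - 1, by omega⟩
    exact ih (h.of_succ hK)

/-- An infinitely good box has, at each height, many infinitely good children. -/
theorem IsInftyGood.exists_children {B : ℝ → ℝ} {τ : ℝ} {K : ℕ} {r s : ℝ}
    (hB : ContinuousOn B (Icc 0 τ)) (hK : 0 < K) {n : ℕ} {R : PathBox}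
    (h : IsInftyGood B τ K r s n R) {m : ℤ} (hm : m ∈ childHeights r K) :
    ∃ S : Finset PathBox, s * K ≤ (S.card : ℝ) ∧
      ∀ R' ∈ S, IsChildAt B τ K n R R' m ∧ IsInftyGood B τ K r s (n + 1) R' := by
  classical
  have hb : ∀ R', ∃ k, 1 ≤ k ∧ (¬ IsInftyGood B τ K r s (n + 1) R' →
      ¬ IsNGood B τ K r s k (n + 1) R') := by
    intro R'
    by_cases h' : IsInftyGood B τ K r s (n + 1) R'
    · exact ⟨1, le_rfl, fun h => absurd h' h⟩
    · have h'' := h'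
      unfold IsInftyGood at h''
      push Not at h''
      obtain ⟨k, hk, hk'⟩ := h''
      exact ⟨k, hk, fun _ => hk'⟩
  choose bad hbad1 hbad using hb
  let T := (finite_setOf_isBox hB hK (n + 1)).toFinset
  -- There are finitely many boxes at scale `n + 1`, so one order exceeds every order at which some
  -- box fails. With `+ 2` here the children are good of order `T.sup bad + 1`, and such a child
  -- cannot fail at any order.
  obtain ⟨S, hc, hS⟩ := (h (T.sup bad + 2) (by omega)).2 m hm
  refine ⟨S, hc, fun R' hR' => ⟨(hS R' hR').1, ?_⟩⟩
  by_contra hcon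
  have hT : R' ∈ T := by simpa [T] using (hS R' hR').1.1
  exact hbad R' hcon ((hS R' hR').2.of_le hK (hbad1 R') ((Finset.le_sup hT).trans (by omega)))

/-- The family of all infinitely good descendants of the root. -/
def goodDescendants (B : ℝ → ℝ) (τ : ℝ) (K : ℕ) (r s : ℝ) : ℕ → Set PathBox
  | 0 => {rootBox τ}
  | n + 1 => {R' | IsInftyGood B τ K r s (n + 1) R' ∧
      ∃ R ∈ goodDescendants B τ K r s n, ∃ m ∈ childHeights r K, IsChildAt B τ K n R R' m}

theorem isNestedFamily_goodDescendants {B : ℝ → ℝ} {τ : ℝ} {K : ℕ} {r s : ℝ}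
    (hB : ContinuousOn B (Icc 0 τ)) (hK : 0 < K)
    (h : IsInftyGood B τ K r s 0 (rootBox τ)) :
    IsNestedFamily B τ K r s (goodDescendants B τ K r s) := by
  have hgood : ∀ n, ∀ R ∈ goodDescendants B τ K r s n, IsInftyGood B τ K r s n R := by
    intro n R hR
    cases n with
    | zero => obtain rfl : R = rootBox τ := hR; exact h
    | succ n => exact hR.1
  refine ⟨rfl, hgood, fun n R' hR' => hR'.2, fun n R hR m hm => ?_⟩
  obtain ⟨S, hc, hS⟩ := (hgood n R hR).exists_children hB hK hm
  exact ⟨S, hc, fun R' hR' => ⟨⟨(hS R' hR').2, R, hR, m, hm, (hS R' hR').1⟩, (hS R' hR').1⟩⟩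

/-! ### The limit set, the graph and its tubular neighbourhoods. -/

/-- The union of the extended boxes of a family at a scale. -/
def extendedUnion (r : ℝ) (K : ℕ) (F : ℕ → Set PathBox) (n : ℕ) : Set (ℝ × ℝ) :=
  ⋃ R ∈ F n, R.extended r K n

theorem isCompact_extendedUnion {B : ℝ → ℝ} {τ : ℝ} {K : ℕ} {r s : ℝ} {F : ℕ → Set PathBox}
    (hB : ContinuousOn B (Icc 0 τ)) (hK : 0 < K) (hF : IsNestedFamily B τ K r s F) (n : ℕ) :
    IsCompact (extendedUnion r K F n) :=
  ((finite_setOf_isBox hB hK n).subset fun R hR => (hF.good n R hR).isBox).isCompact_biUnion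
    fun _ _ => isCompact_Icc.prod isCompact_Icc

theorem isCompact_familyLimitSet {B : ℝ → ℝ} {τ : ℝ} {K : ℕ} {r s : ℝ} {F : ℕ → Set PathBox}
    (hB : ContinuousOn B (Icc 0 τ)) (hK : 0 < K) (hF : IsNestedFamily B τ K r s F) :
    IsCompact (familyLimitSet r K F) :=
  (isCompact_extendedUnion hB hK hF 0).of_isClosed_subset
    (isClosed_iInter fun n => (isCompact_extendedUnion hB hK hF n).isClosed)
    (iInter_subset _ 0)

/-- The points over `[0, τ]` at vertical distance at most `2 K^{-n}` from the path. -/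
def pathTube (B : ℝ → ℝ) (τ : ℝ) (K n : ℕ) : Set (ℝ × ℝ) :=
  {z | z.1 ∈ Icc 0 τ ∧ |z.2 - B z.1| ≤ 2 * mesh K n}

theorem mem_pathGraph_of_forall_mem_pathTube {B : ℝ → ℝ} {τ : ℝ} {K : ℕ} (hK : 1 < K)
    {z : ℝ × ℝ} (h : ∀ n, z ∈ pathTube B τ K n) : z ∈ pathGraph B τ := by
  refine ⟨z.1, (h 0).1, ?_⟩
  have h0 : |z.2 - B z.1| ≤ 0 := by
    have := (tendsto_mesh hK).const_mul 2
    rw [mul_zero] at this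
    exact ge_of_tendsto' this fun n => (h n).2
  have := sub_eq_zero.1 (abs_nonpos_iff.1 h0)
  exact Prod.ext rfl this.symm

theorem familyLimitSet_subset_pathGraph {B : ℝ → ℝ} {τ : ℝ} {K : ℕ} {r s : ℝ}
    {F : ℕ → Set PathBox} (hB : ContinuousOn B (Icc 0 τ)) (hK : 1 < K) (hr : 3 * r ≤ 1)
    (hF : IsNestedFamily B τ K r s F) : familyLimitSet r K F ⊆ pathGraph B τ := by
  intro z hz
  refine mem_pathGraph_of_forall_mem_pathTube hK fun n => ?_
  obtain ⟨R, hR, hzR⟩ := mem_iUnion₂.1 (mem_iInter.1 hz n)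
  exact (hF.good n R hR).isBox.abs_sub_le_of_mem_extended hB (by omega) hr hzR

theorem isCompact_pathGraph {B : ℝ → ℝ} {τ : ℝ} (hB : ContinuousOn B (Icc 0 τ)) :
    IsCompact (pathGraph B τ) :=
  isCompact_Icc.image_of_continuousOn (continuousOn_id.prodMk hB)

theorem measurableSet_pathTube {B : ℝ → ℝ} {τ : ℝ} (hB : ContinuousOn B (Icc 0 τ)) (K n : ℕ) :
    MeasurableSet (pathTube B τ K n) := by
  have hcl : IsClosed (Icc 0 τ ×ˢ (univ : Set ℝ)) := isClosed_Icc.prod isClosed_univ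
  have hc : ContinuousOn (fun z : ℝ × ℝ => |z.2 - B z.1|) (Icc 0 τ ×ˢ (univ : Set ℝ)) :=
    (continuous_snd.continuousOn.sub (hB.comp continuous_fst.continuousOn fun z hz => hz.1)).abs
  have := hc.preimage_isClosed_of_isClosed hcl (isClosed_Iic (a := 2 * mesh K n))
  convert this.measurableSet using 1
  ext z
  simp [pathTube]

theorem volume_pathTube_le {B : ℝ → ℝ} {τ : ℝ} (hB : ContinuousOn B (Icc 0 τ)) (K n : ℕ) :
    volume (pathTube B τ K n) ≤ ENNReal.ofReal (4 * mesh K n) * ENNReal.ofReal τ := by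
  rw [Measure.volume_eq_prod, Measure.prod_apply (measurableSet_pathTube hB K n)]
  calc ∫⁻ x, volume (Prod.mk x ⁻¹' pathTube B τ K n)
      ≤ ∫⁻ x, (Icc 0 τ).indicator (fun _ => ENNReal.ofReal (4 * mesh K n)) x := by
        refine lintegral_mono fun x => ?_
        by_cases hx : x ∈ Icc 0 τ
        · rw [indicator_of_mem hx]
          have : Prod.mk x ⁻¹' pathTube B τ K n ⊆
              Icc (B x - 2 * mesh K n) (B x + 2 * mesh K n) := by
            intro y hy
            have h2 := abs_le.1 hy.2
            exact ⟨by linarith [h2.1], by linarith [h2.2]⟩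
          refine (measure_mono this).trans ?_
          rw [Real.volume_Icc]
          exact ENNReal.ofReal_le_ofReal (by linarith)
        · have : Prod.mk x ⁻¹' pathTube B τ K n = ∅ :=
            eq_empty_of_forall_notMem fun y hy => hx hy.1
          simp [this]
    _ = _ := by
        rw [lintegral_indicator measurableSet_Icc, setLIntegral_const, Real.volume_Icc, sub_zero]

theorem volume_pathGraph {B : ℝ → ℝ} {τ : ℝ} (hB : ContinuousOn B (Icc 0 τ)) :
    volume (pathGraph B τ) = 0 := by
  -- The graph does not depend on the mesh base, so 2 serves as well as any base above 1.
  have h : ∀ n, volume (pathGraph B τ) ≤ ENNReal.ofReal (4 * mesh 2 n) * ENNReal.ofReal τ := by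
    refine fun n => (measure_mono ?_).trans (volume_pathTube_le hB 2 n)
    rintro _ ⟨t, ht, rfl⟩
    exact ⟨ht, by simpa using (mesh_pos two_pos n).le⟩
  have hlim := ENNReal.Tendsto.mul_const (b := ENNReal.ofReal τ) (ENNReal.tendsto_ofReal
    ((tendsto_mesh one_lt_two).const_mul 4)) (Or.inr ENNReal.ofReal_ne_top)
  rw [mul_zero, ENNReal.ofReal_zero, zero_mul] at hlim
  exact le_antisymm (ge_of_tendsto' hlim h) zero_le

/-! ### A smooth partition of unity in the height. -/

/-- A smooth bump supported in `[-3r, 1 - 2r]` whose integer translates sum to `1`. -/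
noncomputable def trapezoid (r t : ℝ) : ℝ :=
  Real.smoothTransition ((t + 3 * r) / r) - Real.smoothTransition ((t + 3 * r - 1) / r)

theorem contDiff_trapezoid (r : ℝ) : ContDiff ℝ ∞ (trapezoid r) :=
  (Real.smoothTransition.contDiff.comp (by fun_prop)).sub
    (Real.smoothTransition.contDiff.comp (by fun_prop))

theorem trapezoid_nonneg {r : ℝ} (hr : 0 < r) (t : ℝ) : 0 ≤ trapezoid r t :=
  sub_nonneg.2 (Real.smoothTransition.monotone (by gcongr; linarith))

theorem trapezoid_le_one (r t : ℝ) : trapezoid r t ≤ 1 := by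
  have h1 := Real.smoothTransition.le_one ((t + 3 * r) / r)
  have h2 := Real.smoothTransition.nonneg ((t + 3 * r - 1) / r)
  unfold trapezoid; linarith

theorem trapezoid_of_notMem {r : ℝ} (hr : 0 < r) {t : ℝ} (ht : t ∉ Icc (-(3 * r)) (1 - 2 * r)) :
    trapezoid r t = 0 := by
  unfold trapezoid
  rw [mem_Icc, not_and_or, not_le, not_le] at ht
  rcases ht with h | h
  · rw [Real.smoothTransition.zero_of_nonpos, Real.smoothTransition.zero_of_nonpos, sub_zero]
    · exact div_nonpos_of_nonpos_of_nonneg (by linarith) hr.le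
    · exact div_nonpos_of_nonpos_of_nonneg (by linarith) hr.le
  · rw [Real.smoothTransition.one_of_one_le, Real.smoothTransition.one_of_one_le, sub_self]
    · rw [le_div_iff₀ hr]; linarith
    · rw [le_div_iff₀ hr]; linarith

theorem deriv_trapezoid_of_notMem {r : ℝ} (hr : 0 < r) {t : ℝ}
    (ht : t ∉ Icc (-(3 * r)) (1 - 2 * r)) : deriv (trapezoid r) t = 0 := by
  have : trapezoid r =ᶠ[nhds t] fun _ => 0 := by
    filter_upwards [isClosed_Icc.isOpen_compl.mem_nhds ht] with u hu
    exact trapezoid_of_notMem hr hu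
  rw [this.deriv_eq, deriv_const]

theorem hasCompactSupport_trapezoid {r : ℝ} (hr : 0 < r) : HasCompactSupport (trapezoid r) :=
  HasCompactSupport.intro isCompact_Icc fun _ => trapezoid_of_notMem hr

theorem exists_abs_deriv_trapezoid_le {r : ℝ} (hr : 0 < r) :
    ∃ D, ∀ t, |deriv (trapezoid r) t| ≤ D :=
  (hasCompactSupport_trapezoid hr).deriv.exists_bound_of_continuous
    ((contDiff_trapezoid r).continuous_deriv (by simp))

/-- The falling edge of each bump is the rising edge of the next, so the sum telescopes. -/
theorem sum_range_trapezoid (r t : ℝ) (N : ℕ) :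
    ∑ i ∈ Finset.range N, trapezoid r (t - i) =
      Real.smoothTransition ((t + 3 * r) / r) - Real.smoothTransition ((t + 3 * r - N) / r) := by
  induction N with
  | zero => simp
  | succ N ih =>
    rw [Finset.sum_range_succ, ih]
    unfold trapezoid
    have h1 : t - N + 3 * r = t + 3 * r - N := by ring
    have h2 : t - N + 3 * r - 1 = t + 3 * r - (N + 1 : ℕ) := by push_cast; ring
    rw [h2, h1]; ring

theorem sum_range_trapezoid_le_one (r t : ℝ) (N : ℕ) :
    ∑ i ∈ Finset.range N, trapezoid r (t - i) ≤ 1 := by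
  have h1 := Real.smoothTransition.le_one ((t + 3 * r) / r)
  have h2 := Real.smoothTransition.nonneg ((t + 3 * r - N) / r)
  rw [sum_range_trapezoid]; linarith

theorem sum_range_trapezoid_eq_one {r : ℝ} (hr : 0 < r) {t : ℝ} {N : ℕ}
    (ht : t ∈ Icc (-(2 * r)) (N - 3 * r)) : ∑ i ∈ Finset.range N, trapezoid r (t - i) = 1 := by
  rw [sum_range_trapezoid, Real.smoothTransition.one_of_one_le,
    Real.smoothTransition.zero_of_nonpos, sub_zero]
  · exact div_nonpos_of_nonpos_of_nonneg (by linarith [ht.2]) hr.le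
  · rw [le_div_iff₀ hr]; linarith [ht.1]

theorem sum_range_deriv_trapezoid_eq_zero {r : ℝ} (hr : 0 < r) {t : ℝ} {N : ℕ}
    (ht : t ∈ Ioo (-(2 * r)) (N - 3 * r)) :
    ∑ i ∈ Finset.range N, deriv (trapezoid r) (t - i) = 0 := by
  have h1 : HasDerivAt (fun u => ∑ i ∈ Finset.range N, trapezoid r (u - i))
      (∑ i ∈ Finset.range N, deriv (trapezoid r) (t - i)) t := by
    refine HasDerivAt.fun_sum fun i _ => ?_
    exact ((contDiff_trapezoid r).differentiable (by simp) _).hasDerivAt.comp_sub_const t i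
  have h2 : (fun u => ∑ i ∈ Finset.range N, trapezoid r (u - i)) =ᶠ[nhds t] fun _ => 1 := by
    filter_upwards [isOpen_Ioo.mem_nhds ht] with u hu
    exact sum_range_trapezoid_eq_one hr (Ioo_subset_Icc_self hu)
  rw [← h1.deriv, h2.deriv_eq, deriv_const]

/-- Weighted sums with weights given by translates of the bump. -/
theorem abs_sum_trapezoid_mul_le {r : ℝ} (hr : 0 < r) {t D : ℝ} (hD : 0 ≤ D) {N : ℕ} {a : ℕ → ℝ}
    (ha : ∀ i ∈ Finset.range N, trapezoid r (t - i) ≠ 0 → |a i| ≤ D) :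
    |∑ i ∈ Finset.range N, trapezoid r (t - i) * a i| ≤ D := by
  calc |∑ i ∈ Finset.range N, trapezoid r (t - i) * a i|
      ≤ ∑ i ∈ Finset.range N, trapezoid r (t - i) * D := by
        refine (Finset.abs_sum_le_sum_abs _ _).trans (Finset.sum_le_sum fun i hi => ?_)
        rw [abs_mul, abs_of_nonneg (trapezoid_nonneg hr _)]
        by_cases h : trapezoid r (t - i) = 0
        · simp [h]
        · exact mul_le_mul_of_nonneg_left (ha i hi h) (trapezoid_nonneg hr _)
    _ ≤ 1 * D := by
        rw [← Finset.sum_mul]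
        exact mul_le_mul_of_nonneg_right (sum_range_trapezoid_le_one r t N) hD
    _ = D := one_mul D

/-! ### Selections of children, averages and the approximating functions. -/

/-- A selection of children in a family of boxes: for every `R ∈ F n` and every height
`i - 3 k`, `i < K + 2 k`, at least `q` children of `R` at that height, over intervals without
common interior points. -/
structure IsSelection (K k : ℕ) (q : ℝ) (F : ℕ → Set PathBox)
    (S : ℕ → PathBox → ℕ → Finset PathBox) : Prop where
  lt : ∀ n, ∀ R ∈ F n, R.left < R.right
  mem : ∀ n, ∀ R ∈ F n, ∀ i ∈ Finset.range (K + 2 * k), ∀ R' ∈ S n R i, R' ∈ F (n + 1)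
  left_le : ∀ n, ∀ R ∈ F n, ∀ i ∈ Finset.range (K + 2 * k), ∀ R' ∈ S n R i, R.left ≤ R'.left
  right_le : ∀ n, ∀ R ∈ F n, ∀ i ∈ Finset.range (K + 2 * k), ∀ R' ∈ S n R i,
    R'.right ≤ R.right
  level : ∀ n, ∀ R ∈ F n, ∀ i ∈ Finset.range (K + 2 * k), ∀ R' ∈ S n R i,
    R'.level = R.level * K + (i - 3 * k)
  le_card : ∀ n, ∀ R ∈ F n, ∀ i ∈ Finset.range (K + 2 * k), q ≤ ((S n R i).card : ℝ)
  disjoint : ∀ n, ∀ R ∈ F n, ∀ i ∈ Finset.range (K + 2 * k), ∀ R₁ ∈ S n R i, ∀ R₂ ∈ S n R i,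
    R₁ = R₂ ∨ R₁.right ≤ R₂.left ∨ R₂.right ≤ R₁.left

/-- The average of a function over a finite set of boxes. -/
noncomputable def boxAverage (T : Finset PathBox) (u : PathBox → ℝ) : ℝ :=
  (T.card : ℝ)⁻¹ * ∑ R ∈ T, u R

theorem boxAverage_nonneg {T : Finset PathBox} {u : PathBox → ℝ} (h : ∀ R ∈ T, 0 ≤ u R) :
    0 ≤ boxAverage T u :=
  mul_nonneg (by positivity) (Finset.sum_nonneg h)

theorem boxAverage_le_one {T : Finset PathBox} {u : PathBox → ℝ} (h : ∀ R ∈ T, u R ≤ 1) :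
    boxAverage T u ≤ 1 := by
  unfold boxAverage
  rcases T.eq_empty_or_nonempty with rfl | hT
  · simp
  · have h0 : (0 : ℝ) < T.card := by exact_mod_cast hT.card_pos
    rw [inv_mul_le_iff₀ h0, mul_one]
    simpa using Finset.sum_le_sum h

theorem boxAverage_sub (T : Finset PathBox) (u v : PathBox → ℝ) :
    boxAverage T u - boxAverage T v = boxAverage T fun R => u R - v R := by
  unfold boxAverage; rw [Finset.sum_sub_distrib]; ring

/-- If only boxes over a given point contribute, then the average over boxes without common
interior points has at most one term. -/
theorem abs_boxAverage_le {T : Finset PathBox} {u : PathBox → ℝ} {q D x : ℝ} (hq : 0 < q)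
    (hcard : q ≤ (T.card : ℝ)) (hD : 0 ≤ D)
    (hdis : ∀ R₁ ∈ T, ∀ R₂ ∈ T, R₁ = R₂ ∨ R₁.right ≤ R₂.left ∨ R₂.right ≤ R₁.left)
    (hu : ∀ R ∈ T, |u R| ≤ D) (h0 : ∀ R ∈ T, x ∉ Ioo R.left R.right → u R = 0) :
    |boxAverage T u| ≤ q⁻¹ * D := by
  unfold boxAverage
  rw [abs_mul, abs_of_nonneg (by positivity)]
  have hsum : |∑ R ∈ T, u R| ≤ D := by
    by_cases h : ∃ R₀ ∈ T, x ∈ Ioo R₀.left R₀.right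
    · obtain ⟨R₀, hR₀, hx⟩ := h
      rw [Finset.sum_eq_single_of_mem R₀ hR₀]
      · exact hu R₀ hR₀
      · intro R hR hne
        refine h0 R hR fun hx' => ?_
        rcases hdis R hR R₀ hR₀ with h | h | h
        · exact hne h
        · linarith [hx.1, hx'.2]
        · linarith [hx.2, hx'.1]
    · push Not at h
      rw [Finset.sum_eq_zero fun R hR => h0 R hR (h R hR)]
      simpa using hD
  exact mul_le_mul (inv_anti₀ hq hcard) hsum (abs_nonneg _) (by positivity)

/-- The height coordinate, in units of the mesh at scale `n + 1`, relative to the lowest possible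
child of `R`. -/
noncomputable def relHeight (K k n : ℕ) (R : PathBox) (y : ℝ) : ℝ :=
  y * (K : ℝ) ^ (n + 1) - (R.level * K - 3 * k)

/-- The approximations, of increasing depth, to a function that increases horizontally from `0` to
`1` across the box `R` at scale `n`, and only inside the descendants of `R`. -/
noncomputable def ladder (r : ℝ) (K k : ℕ) (S : ℕ → PathBox → ℕ → Finset PathBox) :
    ℕ → ℕ → PathBox → ℝ × ℝ → ℝ
  | 0, _, R, z => Real.smoothTransition ((z.1 - R.left) / (R.right - R.left))
  | j + 1, n, R, z => ∑ i ∈ Finset.range (K + 2 * k), trapezoid r (relHeight K k n R z.2 - i) *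
      boxAverage (S n R i) fun R' => ladder r K k S j (n + 1) R' z

/-- The vertical extent of the part of `R` in which the function attached to `R` is used. -/
def activeHeights (r : ℝ) (K n : ℕ) (R : PathBox) : Set ℝ :=
  {y | y * (K : ℝ) ^ n - R.level ∈ Icc (-(3 * r)) (1 - 2 * r)}

section Ladder

variable {r q : ℝ} {K k : ℕ} {F : ℕ → Set PathBox} {S : ℕ → PathBox → ℕ → Finset PathBox}

theorem contDiff_ladder (j n : ℕ) (R : PathBox) : ContDiff ℝ ∞ (ladder r K k S j n R) := by
  induction j generalizing n R with
  | zero => exact Real.smoothTransition.contDiff.comp (by fun_prop)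
  | succ j ih =>
    change ContDiff ℝ ∞ fun z => ladder r K k S (j + 1) n R z
    simp only [ladder, boxAverage, relHeight]
    refine ContDiff.sum fun i _ => ((contDiff_trapezoid r).comp (by fun_prop)).mul ?_
    exact contDiff_const.mul (ContDiff.sum fun R' _ => ih _ R')

theorem ladder_mem_Icc (hr : 0 < r) (j n : ℕ) (R : PathBox) (z : ℝ × ℝ) :
    ladder r K k S j n R z ∈ Icc 0 1 := by
  induction j generalizing n R with
  | zero => exact ⟨Real.smoothTransition.nonneg _, Real.smoothTransition.le_one _⟩
  | succ j ih =>
    have h0 : ∀ i, 0 ≤ boxAverage (S n R i) fun R' => ladder r K k S j (n + 1) R' z :=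
      fun i => boxAverage_nonneg fun R' _ => (ih _ R').1
    constructor
    · exact Finset.sum_nonneg fun i _ => mul_nonneg (trapezoid_nonneg hr _) (h0 i)
    · refine (le_abs_self _).trans (abs_sum_trapezoid_mul_le hr zero_le_one fun i _ _ => ?_)
      rw [abs_of_nonneg (h0 i)]
      exact boxAverage_le_one fun R' _ => (ih _ R').2

theorem ladder_of_le_left (hS : IsSelection K k q F S) {n : ℕ} {R : PathBox} (hR : R ∈ F n)
    (j : ℕ) {z : ℝ × ℝ} (hz : z.1 ≤ R.left) : ladder r K k S j n R z = 0 := by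
  induction j generalizing n R with
  | zero =>
    exact Real.smoothTransition.zero_of_nonpos (div_nonpos_of_nonpos_of_nonneg (by linarith)
      (by linarith [hS.lt n R hR]))
  | succ j ih =>
    refine Finset.sum_eq_zero fun i hi => ?_
    rw [boxAverage, Finset.sum_eq_zero, mul_zero, mul_zero]
    exact fun R' hR' => ih (hS.mem n R hR i hi R' hR') (hz.trans (hS.left_le n R hR i hi R' hR'))

theorem relHeight_sub_eq (hS : IsSelection K k q F S) {n : ℕ} {R : PathBox} (hR : R ∈ F n)
    {i : ℕ} (hi : i ∈ Finset.range (K + 2 * k)) {R' : PathBox} (hR' : R' ∈ S n R i) (y : ℝ) :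
    relHeight K k n R y - i = y * (K : ℝ) ^ (n + 1) - R'.level := by
  rw [relHeight, hS.level n R hR i hi R' hR']; push_cast; ring

theorem mem_activeHeights_of_mem_Icc (hS : IsSelection K k q F S) {n : ℕ} {R : PathBox}
    (hR : R ∈ F n) {i : ℕ} (hi : i ∈ Finset.range (K + 2 * k)) {R' : PathBox}
    (hR' : R' ∈ S n R i) {y : ℝ} (hy : relHeight K k n R y - i ∈ Icc (-(3 * r)) (1 - 2 * r)) :
    y ∈ activeHeights r K (n + 1) R' := by
  rwa [relHeight_sub_eq hS hR hi hR'] at hy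

theorem mem_activeHeights_of_ne_zero (hr : 0 < r) (hS : IsSelection K k q F S) {n : ℕ}
    {R : PathBox} (hR : R ∈ F n) {i : ℕ} (hi : i ∈ Finset.range (K + 2 * k)) {R' : PathBox}
    (hR' : R' ∈ S n R i) {y : ℝ} (hy : trapezoid r (relHeight K k n R y - i) ≠ 0) :
    y ∈ activeHeights r K (n + 1) R' := by
  refine mem_activeHeights_of_mem_Icc hS hR hi hR' ?_
  by_contra h
  exact hy (trapezoid_of_notMem hr h)

/-- At active heights of `R` the relative height lies in `[0, K + k]`. The upper end is below `K + 2
* k - 3 * r` because `3 * r < r * K = k`; this is where `3 < K` enters. So the bumps of the children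
sum to 1 near every active height. -/
theorem relHeight_mem_Ioo (hr : 0 < r) (hrK : r * K = k) (hK : 3 < K) {n : ℕ} {R : PathBox}
    {y : ℝ} (hy : y ∈ activeHeights r K n R) :
    relHeight K k n R y ∈ Ioo (-(2 * r)) ((K + 2 * k : ℕ) - 3 * r) := by
  have hK' : (3 : ℝ) < K := by exact_mod_cast hK
  have h1 := mul_le_mul_of_nonneg_right hy.1 (by positivity : (0 : ℝ) ≤ K)
  have h2 := mul_le_mul_of_nonneg_right hy.2 (by positivity : (0 : ℝ) ≤ K)
  have h3 : relHeight K k n R y = (y * (K : ℝ) ^ n - R.level) * K + 3 * (r * K) := by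
    rw [relHeight, hrK]; ring
  have h4 := mul_lt_mul_of_pos_left hK' hr
  rw [h3]
  push_cast
  rw [← hrK]
  constructor <;> nlinarith

theorem card_pos_of_mem_range (hq : 0 < q) (hS : IsSelection K k q F S) {n : ℕ} {R : PathBox}
    (hR : R ∈ F n) {i : ℕ} (hi : i ∈ Finset.range (K + 2 * k)) : 0 < ((S n R i).card : ℝ) :=
  hq.trans_le (hS.le_card n R hR i hi)

theorem boxAverage_eq_one {T : Finset PathBox} {u : PathBox → ℝ} (hT : 0 < (T.card : ℝ))
    (h : ∀ R ∈ T, u R = 1) : boxAverage T u = 1 := by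
  rw [boxAverage, Finset.sum_congr rfl h]; simp [hT.ne']

/-- Inductively, all relevant averages equal 1, and the bumps sum to 1 at active heights. -/
theorem ladder_of_right_le (hr : 0 < r) (hq : 0 < q) (hrK : r * K = k) (hK : 3 < K)
    (hS : IsSelection K k q F S) {n : ℕ} {R : PathBox} (hR : R ∈ F n) (j : ℕ) {z : ℝ × ℝ}
    (hz : R.right ≤ z.1) (hy : z.2 ∈ activeHeights r K n R) : ladder r K k S j n R z = 1 := by
  induction j generalizing n R with
  | zero =>
    refine Real.smoothTransition.one_of_one_le ?_
    rw [le_div_iff₀ (sub_pos.2 (hS.lt n R hR))]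
    linarith
  | succ j ih =>
    rw [← sum_range_trapezoid_eq_one hr (Ioo_subset_Icc_self (relHeight_mem_Ioo hr hrK hK hy))]
    refine Finset.sum_congr rfl fun i hi => ?_
    by_cases h0 : trapezoid r (relHeight K k n R z.2 - i) = 0
    · rw [h0, zero_mul]
    · rw [boxAverage_eq_one (card_pos_of_mem_range hq hS hR hi), mul_one]
      exact fun R' hR' => ih (hS.mem n R hR i hi R' hR')
        ((hS.right_le n R hR i hi R' hR').trans hz)
        (mem_activeHeights_of_ne_zero hr hS hR hi hR' h0)

/-- This is what lets only the child over `z.1` contribute to an average of differences between two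
depths. -/
theorem ladder_eq_of_notMem_Ioo (hr : 0 < r) (hq : 0 < q) (hrK : r * K = k) (hK : 3 < K)
    (hS : IsSelection K k q F S) {n : ℕ} {R : PathBox} (hR : R ∈ F n) (i j : ℕ) {z : ℝ × ℝ}
    (hz : z.1 ∉ Ioo R.left R.right) (hy : z.2 ∈ activeHeights r K n R) :
    ladder r K k S i n R z = ladder r K k S j n R z := by
  rw [mem_Ioo, not_and_or, not_lt, not_lt] at hz
  rcases hz with h | h
  · rw [ladder_of_le_left hS hR _ h, ladder_of_le_left hS hR _ h]
  · rw [ladder_of_right_le hr hq hrK hK hS hR _ h hy, ladder_of_right_le hr hq hrK hK hS hR _ h hy]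

theorem ladder_succ_sub (i j n : ℕ) (R : PathBox) (z : ℝ × ℝ) :
    ladder r K k S (i + 1) n R z - ladder r K k S (j + 1) n R z =
      ∑ l ∈ Finset.range (K + 2 * k), trapezoid r (relHeight K k n R z.2 - l) *
        boxAverage (S n R l) fun R' =>
          ladder r K k S i (n + 1) R' z - ladder r K k S j (n + 1) R' z := by
  simp only [ladder, ← Finset.sum_sub_distrib, ← mul_sub, boxAverage_sub]

/-- The approximations converge geometrically. -/
theorem abs_ladder_succ_sub_le (hr : 0 < r) (hq : 0 < q) (hrK : r * K = k) (hK : 3 < K)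
    (hS : IsSelection K k q F S) {n : ℕ} {R : PathBox} (hR : R ∈ F n) (j : ℕ) {z : ℝ × ℝ}
    (hy : z.2 ∈ activeHeights r K n R) :
    |ladder r K k S (j + 1) n R z - ladder r K k S j n R z| ≤ (q⁻¹) ^ j := by
  induction j generalizing n R with
  | zero =>
    have h1 := ladder_mem_Icc (K := K) (k := k) (S := S) hr 1 n R z
    have h2 := ladder_mem_Icc (K := K) (k := k) (S := S) hr 0 n R z
    rw [pow_zero, abs_le]
    constructor <;> linarith [h1.1, h1.2, h2.1, h2.2]
  | succ j ih =>
    rw [ladder_succ_sub]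
    refine abs_sum_trapezoid_mul_le hr (by positivity) fun i hi h0 => ?_
    rw [pow_succ']
    -- At most one child has `z.1` in the interior of its interval, so averaging gains a factor
    -- `q⁻¹`.
    refine abs_boxAverage_le (x := z.1) hq (hS.le_card n R hR i hi) (by positivity)
      (hS.disjoint n R hR i hi) (fun R' hR' => ?_) (fun R' hR' hx => ?_)
    · exact ih (hS.mem n R hR i hi R' hR') (mem_activeHeights_of_ne_zero hr hS hR hi hR' h0)
    · exact sub_eq_zero.2 (ladder_eq_of_notMem_Ioo hr hq hrK hK hS (hS.mem n R hR i hi R' hR') _ _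
        hx (mem_activeHeights_of_ne_zero hr hS hR hi hR' h0))

theorem mem_extendedUnion (hr : 0 < r) (hK : 0 < K) {n : ℕ} {R : PathBox} (hR : R ∈ F n)
    {z : ℝ × ℝ} (hx : z.1 ∈ Icc R.left R.right) (hy : z.2 ∈ activeHeights r K n R) :
    z ∈ extendedUnion r K F n := by
  have hK' : (0 : ℝ) < (K : ℝ) ^ n := by positivity
  refine mem_iUnion₂.2 ⟨R, hR, hx, ?_, ?_⟩
  · rw [mesh, mul_inv_le_iff₀ hK']; linarith [hy.1]
  · rw [mesh, le_mul_inv_iff₀ hK']; linarith [hy.2]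

/-- The approximation of depth `j` changes only inside the boxes at the first `j + 1` scales. -/
theorem mem_extendedUnion_of_ladder_ne (hr : 0 < r) (hq : 0 < q) (hrK : r * K = k) (hK : 3 < K)
    (hS : IsSelection K k q F S) {n : ℕ} {R : PathBox} (hR : R ∈ F n) {j : ℕ} {z : ℝ × ℝ}
    (hy : z.2 ∈ activeHeights r K n R)
    (hne : ladder r K k S (j + 1) n R z ≠ ladder r K k S j n R z) {i : ℕ} (hi : i ≤ j) :
    z ∈ extendedUnion r K F (n + i) := by
  have hx : z.1 ∈ Ioo R.left R.right := by
    by_contra hx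
    exact hne (ladder_eq_of_notMem_Ioo hr hq hrK hK hS hR _ _ hx hy)
  induction j generalizing n R i with
  | zero =>
    obtain rfl := Nat.le_zero.1 hi
    exact mem_extendedUnion hr (by omega) hR (Ioo_subset_Icc_self hx) hy
  | succ j ih =>
    cases i with
    | zero => exact mem_extendedUnion hr (by omega) hR (Ioo_subset_Icc_self hx) hy
    | succ i =>
      -- A change in `R` forces a change in some selected child, at one of its active heights.
      rw [← sub_ne_zero, ladder_succ_sub] at hne
      obtain ⟨l, hl, hl0⟩ := Finset.exists_ne_zero_of_sum_ne_zero hne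
      obtain ⟨R', hR', hR'0⟩ :=
        Finset.exists_ne_zero_of_sum_ne_zero (right_ne_zero_of_mul (right_ne_zero_of_mul hl0))
      have hF := hS.mem n R hR l hl R' hR'
      have hy' := mem_activeHeights_of_ne_zero hr hS hR hl hR' (left_ne_zero_of_mul hl0)
      have := ih hF hy' (sub_ne_zero.1 hR'0) (Nat.le_of_succ_le_succ hi) (by
        by_contra hx
        exact hR'0 (sub_eq_zero.2 (ladder_eq_of_notMem_Ioo hr hq hrK hK hS hF _ _ hx hy')))
      rwa [add_assoc, add_comm 1 i] at this

/-! ### Derivatives of the approximating functions. -/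

theorem fderiv_ladder_succ (j n : ℕ) (R : PathBox) (z v : ℝ × ℝ) :
    fderiv ℝ (ladder r K k S (j + 1) n R) z v =
      ∑ i ∈ Finset.range (K + 2 * k),
        (deriv (trapezoid r) (relHeight K k n R z.2 - i) * ((K : ℝ) ^ (n + 1) * v.2) *
            (boxAverage (S n R i) fun R' => ladder r K k S j (n + 1) R' z) +
          trapezoid r (relHeight K k n R z.2 - i) *
            boxAverage (S n R i) fun R' => fderiv ℝ (ladder r K k S j (n + 1) R') z v) := by
  have hlad : ∀ R' : PathBox, HasFDerivAt (ladder r K k S j (n + 1) R')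
      (fderiv ℝ (ladder r K k S j (n + 1) R') z) z := fun R' =>
    ((contDiff_ladder j (n + 1) R').differentiable (by simp) z).hasFDerivAt
  have hrel : ∀ i : ℕ, HasFDerivAt (fun w : ℝ × ℝ => relHeight K k n R w.2 - i)
      ((K : ℝ) ^ (n + 1) • ContinuousLinearMap.snd ℝ ℝ ℝ) z := fun i => by
    unfold relHeight
    exact ((hasFDerivAt_snd.mul_const _).sub_const _).sub_const _
  have htrap : ∀ i : ℕ, HasFDerivAt (fun w : ℝ × ℝ => trapezoid r (relHeight K k n R w.2 - i))
      (deriv (trapezoid r) (relHeight K k n R z.2 - i) •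
        ((K : ℝ) ^ (n + 1) • ContinuousLinearMap.snd ℝ ℝ ℝ)) z := fun i =>
    ((contDiff_trapezoid r).differentiable (by simp) _).hasDerivAt.comp_hasFDerivAt z (hrel i)
  have hsum : HasFDerivAt (ladder r K k S (j + 1) n R) _ z :=
    HasFDerivAt.fun_sum (u := Finset.range (K + 2 * k)) fun i _ =>
      (htrap i).mul ((HasFDerivAt.fun_sum (u := S n R i) fun R' _ => hlad R').const_mul _)
  rw [hsum.fderiv]
  simp only [_root_.sum_apply, boxAverage, _root_.add_apply,
    _root_.smul_apply, ContinuousLinearMap.coe_snd', smul_eq_mul]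
  refine Finset.sum_congr rfl fun i _ => ?_
  ring

end Ladder

section LadderDeriv

variable {r q : ℝ} {K k : ℕ} {F : ℕ → Set PathBox} {S : ℕ → PathBox → ℕ → Finset PathBox}

theorem fderiv_ladder_zero (n : ℕ) (R : PathBox) (z v : ℝ × ℝ) :
    fderiv ℝ (ladder r K k S 0 n R) z v =
      deriv Real.smoothTransition ((z.1 - R.left) / (R.right - R.left)) *
        ((R.right - R.left)⁻¹ * v.1) := by
  have h1 : HasFDerivAt (fun w : ℝ × ℝ => (w.1 - R.left) / (R.right - R.left))
      ((R.right - R.left)⁻¹ • ContinuousLinearMap.fst ℝ ℝ ℝ) z := by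
    simp only [div_eq_mul_inv]
    exact (hasFDerivAt_fst.sub_const _).mul_const _
  have h2 : HasFDerivAt (ladder r K k S 0 n R) _ z :=
    ((Real.smoothTransition.contDiff (n := 1)).differentiable (by simp) _).hasDerivAt.comp_hasFDerivAt
      z h1
  rw [h2.fderiv]
  simp

theorem deriv_smoothTransition_of_notMem {t : ℝ} (ht : t ∉ Icc 0 1) :
    deriv Real.smoothTransition t = 0 := by
  rw [mem_Icc, not_and_or, not_le, not_le] at ht
  rcases ht with h | h
  · have : Real.smoothTransition =ᶠ[nhds t] fun _ => 0 := by
      filter_upwards [isOpen_Iio.mem_nhds h] with u hu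
      exact Real.smoothTransition.zero_of_nonpos (le_of_lt hu)
    rw [this.deriv_eq, deriv_const]
  · have : Real.smoothTransition =ᶠ[nhds t] fun _ => 1 := by
      filter_upwards [isOpen_Ioi.mem_nhds h] with u hu
      exact Real.smoothTransition.one_of_one_le (le_of_lt hu)
    rw [this.deriv_eq, deriv_const]

theorem fderiv_ladder_horizontal_of_notMem (hS : IsSelection K k q F S) {n : ℕ} {R : PathBox}
    (hR : R ∈ F n) (j : ℕ) {z : ℝ × ℝ} (hz : z.1 ∉ Icc R.left R.right) :
    fderiv ℝ (ladder r K k S j n R) z (1, 0) = 0 := by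
  induction j generalizing n R with
  | zero =>
    rw [fderiv_ladder_zero, deriv_smoothTransition_of_notMem, zero_mul]
    have hlt := sub_pos.2 (hS.lt n R hR)
    rintro ⟨h0, h1⟩
    rw [div_le_iff₀ hlt] at h1
    rw [le_div_iff₀ hlt] at h0
    exact hz ⟨by linarith, by linarith⟩
  | succ j ih =>
    rw [fderiv_ladder_succ]
    refine Finset.sum_eq_zero fun i hi => ?_
    have h0 : (boxAverage (S n R i) fun R' => fderiv ℝ (ladder r K k S j (n + 1) R') z (1, 0)) = 0 := by
      rw [boxAverage, Finset.sum_eq_zero, mul_zero]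
      exact fun R' hR' => ih (hS.mem n R hR i hi R' hR') fun h =>
        hz ⟨(hS.left_le n R hR i hi R' hR').trans h.1, h.2.trans (hS.right_le n R hR i hi R' hR')⟩
    simp [h0]

/-- The horizontal derivative of the approximation of depth `j` lives in the boxes at the first
`j + 1` scales. -/
theorem mem_extendedUnion_of_fderiv_ne (hr : 0 < r) (hK : 0 < K) (hS : IsSelection K k q F S)
    {n : ℕ} {R : PathBox} (hR : R ∈ F n) {j : ℕ} {z : ℝ × ℝ}
    (hy : z.2 ∈ activeHeights r K n R)
    (hne : fderiv ℝ (ladder r K k S j n R) z (1, 0) ≠ 0) {i : ℕ} (hi : i ≤ j) :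
    z ∈ extendedUnion r K F (n + i) := by
  induction j generalizing n R i with
  | zero =>
    obtain rfl := Nat.le_zero.1 hi
    refine mem_extendedUnion hr hK hR ?_ hy
    by_contra hx
    exact hne (fderiv_ladder_horizontal_of_notMem hS hR _ hx)
  | succ j ih =>
    cases i with
    | zero =>
      refine mem_extendedUnion hr hK hR ?_ hy
      by_contra hx
      exact hne (fderiv_ladder_horizontal_of_notMem hS hR _ hx)
    | succ i =>
      rw [fderiv_ladder_succ] at hne
      obtain ⟨l, hl, hl0⟩ := Finset.exists_ne_zero_of_sum_ne_zero hne
      simp only [mul_zero, zero_mul, zero_add] at hl0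
      obtain ⟨R', hR', hR'0⟩ :=
        Finset.exists_ne_zero_of_sum_ne_zero (right_ne_zero_of_mul (right_ne_zero_of_mul hl0))
      have := ih (hS.mem n R hR l hl R' hR')
        (mem_activeHeights_of_ne_zero hr hS hR hl hR' (left_ne_zero_of_mul hl0)) hR'0
        (Nat.le_of_succ_le_succ hi)
      rwa [add_assoc, add_comm 1 i] at this

/-- The terms with derivatives of the children vanish by induction. In the terms with derivatives of
the bumps, the averages are 0 to the left of `R`; to the right they are 1 wherever the bump
derivative can be nonzero, and the derivatives of a partition of unity sum to 0. -/
theorem fderiv_ladder_vertical_of_notMem (hr : 0 < r) (hq : 0 < q) (hrK : r * K = k) (hK : 3 < K)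
    (hS : IsSelection K k q F S) {n : ℕ} {R : PathBox} (hR : R ∈ F n) (j : ℕ) {z : ℝ × ℝ}
    (hz : z.1 ∉ Ioo R.left R.right) (hy : z.2 ∈ activeHeights r K n R) :
    fderiv ℝ (ladder r K k S j n R) z (0, 1) = 0 := by
  induction j generalizing n R with
  | zero => simp [fderiv_ladder_zero]
  | succ j ih =>
    have hz' : ∀ i ∈ Finset.range (K + 2 * k), ∀ R' ∈ S n R i, z.1 ∉ Ioo R'.left R'.right :=
      fun i hi R' hR' h => hz ⟨(hS.left_le n R hR i hi R' hR').trans_lt h.1,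
        h.2.trans_le (hS.right_le n R hR i hi R' hR')⟩
    have h2 : ∀ i ∈ Finset.range (K + 2 * k), trapezoid r (relHeight K k n R z.2 - i) *
        (boxAverage (S n R i) fun R' => fderiv ℝ (ladder r K k S j (n + 1) R') z (0, 1)) = 0 := by
      intro i hi
      by_cases h0 : trapezoid r (relHeight K k n R z.2 - i) = 0
      · rw [h0, zero_mul]
      · rw [boxAverage, Finset.sum_eq_zero, mul_zero, mul_zero]
        exact fun R' hR' => ih (hS.mem n R hR i hi R' hR') (hz' i hi R' hR')
          (mem_activeHeights_of_ne_zero hr hS hR hi hR' h0)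
    rw [fderiv_ladder_succ, Finset.sum_add_distrib, Finset.sum_eq_zero h2, add_zero]
    rw [mem_Ioo, not_and_or, not_lt, not_lt] at hz
    rcases hz with h | h
    · refine Finset.sum_eq_zero fun i hi => ?_
      rw [boxAverage, Finset.sum_eq_zero, mul_zero, mul_zero]
      exact fun R' hR' => ladder_of_le_left hS (hS.mem n R hR i hi R' hR') _
        (h.trans (hS.left_le n R hR i hi R' hR'))
    · have h3 : ∀ i ∈ Finset.range (K + 2 * k),
          deriv (trapezoid r) (relHeight K k n R z.2 - i) * ((K : ℝ) ^ (n + 1) * ((0, 1) : ℝ × ℝ).2) *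
            (boxAverage (S n R i) fun R' => ladder r K k S j (n + 1) R' z) =
          deriv (trapezoid r) (relHeight K k n R z.2 - i) * (K : ℝ) ^ (n + 1) := by
        intro i hi
        by_cases h0 : relHeight K k n R z.2 - i ∈ Icc (-(3 * r)) (1 - 2 * r)
        · rw [boxAverage_eq_one (card_pos_of_mem_range hq hS hR hi), mul_one, mul_one]
          exact fun R' hR' => ladder_of_right_le hr hq hrK hK hS (hS.mem n R hR i hi R' hR') _
            ((hS.right_le n R hR i hi R' hR').trans h)
            (mem_activeHeights_of_mem_Icc hS hR hi hR' h0)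
        · simp [deriv_trapezoid_of_notMem hr h0]
      rw [Finset.sum_congr rfl h3, ← Finset.sum_mul,
        sum_range_deriv_trapezoid_eq_zero hr (relHeight_mem_Ioo hr hrK hK hy), zero_mul]

/-- Each scale adds a bump-derivative term of order `K ^ (n + i)`, damped by `(t * K)⁻¹` for each of
the `i` averages above it, hence of order `K ^ n * (t⁻¹) ^ i`, and present only over boxes of that
scale. -/
theorem abs_fderiv_ladder_vertical_le (hr : 0 < r) {t : ℝ} (ht : 0 < t) (hrK : r * K = k)
    (hK : 3 < K) (hS : IsSelection K k (t * K) F S) {T : ℕ → Set (ℝ × ℝ)}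
    (hT : ∀ n, extendedUnion r K F n ⊆ T n) {D : ℝ} (hD : ∀ u, |deriv (trapezoid r) u| ≤ D)
    {n : ℕ} {R : PathBox} (hR : R ∈ F n) (j : ℕ) {z : ℝ × ℝ}
    (hy : z.2 ∈ activeHeights r K n R) :
    |fderiv ℝ (ladder r K k S j n R) z (0, 1)| ≤ (K + 2 * k : ℕ) * (D * K) * (K : ℝ) ^ n *
      ∑ i ∈ Finset.range j, (t⁻¹) ^ i * (T (n + i)).indicator 1 z := by
  have hK0 : (0 : ℝ) < K := by exact_mod_cast (by omega : 0 < K)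
  have hq : 0 < t * K := by positivity
  have hD0 : 0 ≤ D := (abs_nonneg _).trans (hD 0)
  have hind : ∀ m, 0 ≤ (T m).indicator (1 : ℝ × ℝ → ℝ) z := fun m =>
    indicator_nonneg (fun _ _ => zero_le_one) _
  have hnn : ∀ n j, 0 ≤ (K + 2 * k : ℕ) * (D * K) * (K : ℝ) ^ n *
      ∑ i ∈ Finset.range j, (t⁻¹) ^ i * (T (n + i)).indicator 1 z := fun n j =>
    mul_nonneg (by positivity) (Finset.sum_nonneg fun i _ => mul_nonneg (by positivity) (hind _))
  induction j generalizing n R with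
  | zero => simp [fderiv_ladder_zero]
  | succ j ih =>
    by_cases hx : z.1 ∈ Ioo R.left R.right
    swap
    · rw [fderiv_ladder_vertical_of_notMem hr hq hrK hK hS hR _ hx hy, abs_zero]
      exact hnn _ _
    have hzT : z ∈ T n :=
      hT n (mem_extendedUnion hr (by omega) hR (Ioo_subset_Icc_self hx) hy)
    -- The summand `i = 0` pays for the derivatives of the bumps, the shifted summands for the
    -- averaged derivatives of the children.
    rw [fderiv_ladder_succ, Finset.sum_add_distrib, Finset.sum_range_succ', pow_zero, one_mul,
      add_zero, indicator_of_mem hzT, Pi.one_apply, mul_add, add_comm]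
    refine (abs_add_le _ _).trans (add_le_add ?_ ?_)
    · have hbound : ∀ i ∈ Finset.range (K + 2 * k), trapezoid r (relHeight K k n R z.2 - i) ≠ 0 →
          |boxAverage (S n R i) fun R' => fderiv ℝ (ladder r K k S j (n + 1) R') z (0, 1)| ≤
          (t * K)⁻¹ * ((K + 2 * k : ℕ) * (D * K) * (K : ℝ) ^ (n + 1) *
            ∑ i ∈ Finset.range j, (t⁻¹) ^ i * (T (n + 1 + i)).indicator 1 z) := by
        intro i hi h0
        refine abs_boxAverage_le (x := z.1) hq (hS.le_card n R hR i hi) (hnn _ _)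
          (hS.disjoint n R hR i hi) (fun R' hR' => ?_) (fun R' hR' hx => ?_)
        · exact ih (hS.mem n R hR i hi R' hR') (mem_activeHeights_of_ne_zero hr hS hR hi hR' h0)
        · exact fderiv_ladder_vertical_of_notMem hr hq hrK hK hS (hS.mem n R hR i hi R' hR') _ hx
            (mem_activeHeights_of_ne_zero hr hS hR hi hR' h0)
      refine (abs_sum_trapezoid_mul_le hr (mul_nonneg (by positivity) (hnn _ _)) hbound).trans ?_
      -- The average turns the factor of the next scale into `(t * K)⁻¹ * K ^ (n + 1) = t⁻¹ * K ^
      -- n`.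
      refine le_of_eq ?_
      have : ∑ i ∈ Finset.range j, (t⁻¹) ^ (i + 1) * (T (n + (i + 1))).indicator 1 z =
          t⁻¹ * ∑ i ∈ Finset.range j, (t⁻¹) ^ i * (T (n + 1 + i)).indicator 1 z := by
        rw [Finset.mul_sum]
        refine Finset.sum_congr rfl fun i _ => ?_
        rw [pow_succ', mul_assoc, add_assoc, add_comm 1 i]
      rw [this]
      field_simp
      ring
    · calc |∑ i ∈ Finset.range (K + 2 * k), deriv (trapezoid r) (relHeight K k n R z.2 - i) *
            ((K : ℝ) ^ (n + 1) * ((0, 1) : ℝ × ℝ).2) *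
            (boxAverage (S n R i) fun R' => ladder r K k S j (n + 1) R' z)|
          ≤ ∑ i ∈ Finset.range (K + 2 * k), D * (K : ℝ) ^ (n + 1) := by
            refine (Finset.abs_sum_le_sum_abs _ _).trans (Finset.sum_le_sum fun i _ => ?_)
            have h0 : 0 ≤ boxAverage (S n R i) fun R' => ladder r K k S j (n + 1) R' z :=
              boxAverage_nonneg fun R' _ => (ladder_mem_Icc hr _ _ R' z).1
            have h1 : (boxAverage (S n R i) fun R' => ladder r K k S j (n + 1) R' z) ≤ 1 :=
              boxAverage_le_one fun R' _ => (ladder_mem_Icc hr _ _ R' z).2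
            rw [abs_mul, abs_mul, mul_one, abs_of_nonneg h0,
              abs_of_nonneg (by positivity : (0 : ℝ) ≤ (K : ℝ) ^ (n + 1))]
            refine mul_le_of_le_one_right (by positivity) h1 |>.trans ?_
            exact mul_le_mul_of_nonneg_right (hD _) (by positivity)
        _ = _ := by
            rw [Finset.sum_const, Finset.card_range, nsmul_eq_mul]
            ring

end LadderDeriv

/-! ### Cutoffs, product rules and a geometric sum. -/

/-- A smooth cutoff that is `1` on `[a, b]` and `0` off `[a - 1, b + 1]`. -/
noncomputable def plateau (a b x : ℝ) : ℝ :=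
  Real.smoothTransition (x - a + 1) * Real.smoothTransition (b + 1 - x)

theorem contDiff_plateau (a b : ℝ) : ContDiff ℝ ∞ (plateau a b) :=
  (Real.smoothTransition.contDiff.comp (by fun_prop)).mul
    (Real.smoothTransition.contDiff.comp (by fun_prop))

theorem plateau_of_mem {a b x : ℝ} (hx : x ∈ Icc a b) : plateau a b x = 1 := by
  rw [plateau, Real.smoothTransition.one_of_one_le (by linarith [hx.1]),
    Real.smoothTransition.one_of_one_le (by linarith [hx.2]), mul_one]

theorem plateau_of_notMem {a b x : ℝ} (hx : x ∉ Icc (a - 1) (b + 1)) : plateau a b x = 0 := by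
  rw [mem_Icc, not_and_or, not_le, not_le] at hx
  rcases hx with h | h
  · rw [plateau, Real.smoothTransition.zero_of_nonpos (by linarith), zero_mul]
  · rw [plateau, Real.smoothTransition.zero_of_nonpos (x := b + 1 - x) (by linarith), mul_zero]

theorem abs_plateau_le_one (a b x : ℝ) : |plateau a b x| ≤ 1 := by
  rw [plateau, abs_of_nonneg
    (mul_nonneg (Real.smoothTransition.nonneg _) (Real.smoothTransition.nonneg _))]
  exact mul_le_one₀ (Real.smoothTransition.le_one _) (Real.smoothTransition.nonneg _)
    (Real.smoothTransition.le_one _)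

theorem hasCompactSupport_plateau (a b : ℝ) : HasCompactSupport (plateau a b) :=
  HasCompactSupport.intro isCompact_Icc fun _ => plateau_of_notMem

theorem deriv_plateau_of_mem {a b x : ℝ} (hx : x ∈ Ioo a b) : deriv (plateau a b) x = 0 := by
  have : plateau a b =ᶠ[nhds x] fun _ => 1 := by
    filter_upwards [isOpen_Ioo.mem_nhds hx] with u hu
    exact plateau_of_mem (Ioo_subset_Icc_self hu)
  rw [this.deriv_eq, deriv_const]

theorem deriv_plateau_of_notMem {a b x : ℝ} (hx : x ∉ Icc (a - 1) (b + 1)) :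
    deriv (plateau a b) x = 0 := by
  have : plateau a b =ᶠ[nhds x] fun _ => 0 := by
    filter_upwards [isClosed_Icc.isOpen_compl.mem_nhds hx] with u hu
    exact plateau_of_notMem hu
  rw [this.deriv_eq, deriv_const]

theorem integral_Ioi_deriv_plateau {a b : ℝ} (hab : a ≤ b) :
    ∫ x in Ioi b, deriv (plateau a b) x = -1 := by
  have hd : ∀ x, HasDerivAt (plateau a b) (deriv (plateau a b) x) x := fun x =>
    ((contDiff_plateau a b).differentiable (by simp) x).hasDerivAt
  rw [integral_Ioi_of_hasDerivAt_of_tendsto' (m := 0) (fun x _ => hd x), plateau_of_mem ⟨hab, le_rfl⟩,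
    zero_sub]
  · exact (((contDiff_plateau a b).continuous_deriv (by simp)).integrable_of_hasCompactSupport
      (hasCompactSupport_plateau a b).deriv).integrableOn
  · refine tendsto_const_nhds.congr' ?_
    filter_upwards [Filter.eventually_gt_atTop (b + 1)] with x hx
    exact (plateau_of_notMem fun h => by linarith [h.2]).symm

theorem fderiv_comp_fst_mul {g : ℝ → ℝ} {f : ℝ × ℝ → ℝ} {z : ℝ × ℝ} (v : ℝ × ℝ)
    (hg : Differentiable ℝ g) (hf : DifferentiableAt ℝ f z) :
    fderiv ℝ (fun w => g w.1 * f w) z v =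
      deriv g z.1 * v.1 * f z + g z.1 * fderiv ℝ f z v := by
  have h1 : HasFDerivAt (fun w : ℝ × ℝ => g w.1)
      (deriv g z.1 • ContinuousLinearMap.fst ℝ ℝ ℝ) z :=
    (hg z.1).hasDerivAt.comp_hasFDerivAt z hasFDerivAt_fst
  rw [(h1.fun_mul hf.hasFDerivAt).fderiv]
  simp only [_root_.add_apply, _root_.smul_apply, ContinuousLinearMap.coe_fst', smul_eq_mul]
  ring

theorem fderiv_comp_snd_mul {g : ℝ → ℝ} {f : ℝ × ℝ → ℝ} {z : ℝ × ℝ} (v : ℝ × ℝ)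
    (hg : Differentiable ℝ g) (hf : DifferentiableAt ℝ f z) :
    fderiv ℝ (fun w => g w.2 * f w) z v =
      deriv g z.2 * v.2 * f z + g z.2 * fderiv ℝ f z v := by
  have h1 : HasFDerivAt (fun w : ℝ × ℝ => g w.2)
      (deriv g z.2 • ContinuousLinearMap.snd ℝ ℝ ℝ) z :=
    (hg z.2).hasDerivAt.comp_hasFDerivAt z hasFDerivAt_snd
  rw [(h1.fun_mul hf.hasFDerivAt).fderiv]
  simp only [_root_.add_apply, _root_.smul_apply, ContinuousLinearMap.coe_snd', smul_eq_mul]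
  ring

/-- A geometric sum over the sets that contain a point is dominated by its last term. -/
theorem sum_geometric_indicator_le {α : Type*} {T : ℕ → Set α} {t : ℝ} (ht0 : 0 < t) (ht1 : t < 1)
    (z : α) (N : ℕ) :
    ∑ i ∈ Finset.range N, (t⁻¹) ^ i * (T i).indicator (1 : α → ℝ) z = 0 ∨
      ∃ M, z ∈ T M ∧
        ∑ i ∈ Finset.range N, (t⁻¹) ^ i * (T i).indicator (1 : α → ℝ) z ≤
          (1 - t)⁻¹ * (t⁻¹) ^ M := by
  have hgeom : ∀ M, ∑ i ∈ Finset.range (M + 1), (t⁻¹) ^ i ≤ (1 - t)⁻¹ * (t⁻¹) ^ M := by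
    intro M
    have h1 : 0 < 1 - t := by linarith
    induction M with
    | zero =>
      simp only [zero_add, Finset.range_one, Finset.sum_singleton, pow_zero, mul_one]
      exact one_le_inv_iff₀.2 ⟨h1, by linarith⟩
    | succ M ih =>
      rw [Finset.sum_range_succ]
      refine (add_le_add_left ih _).trans (le_of_eq ?_)
      rw [pow_succ]
      field_simp
      ring
  induction N with
  | zero => simp
  | succ N ih =>
    by_cases hz : z ∈ T N
    · refine Or.inr ⟨N, hz, (Finset.sum_le_sum fun i _ => ?_).trans (hgeom N)⟩
      refine mul_le_of_le_one_right (by positivity) ?_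
      exact indicator_le_self' (fun _ _ => zero_le_one) z
    · rwa [Finset.sum_range_succ, indicator_of_notMem hz, mul_zero, add_zero]

/-! ### The limit function. -/

section Limit

variable {r q : ℝ} {K k : ℕ} {F : ℕ → Set PathBox} {S : ℕ → PathBox → ℕ → Finset PathBox}
  {R₀ : PathBox}

/-- The approximations attached to a box at scale `0`, cut off vertically. -/
noncomputable def rootLadder (r : ℝ) (K k : ℕ) (S : ℕ → PathBox → ℕ → Finset PathBox)
    (R₀ : PathBox) (j : ℕ) (z : ℝ × ℝ) : ℝ :=
  trapezoid r (z.2 - R₀.level) * ladder r K k S j 0 R₀ z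

/-- The limit of the approximations. -/
noncomputable def limitLadder (r : ℝ) (K k : ℕ) (S : ℕ → PathBox → ℕ → Finset PathBox)
    (R₀ : PathBox) (z : ℝ × ℝ) : ℝ :=
  rootLadder r K k S R₀ 0 z +
    ∑' j, (rootLadder r K k S R₀ (j + 1) z - rootLadder r K k S R₀ j z)

theorem contDiff_rootLadder (j : ℕ) : ContDiff ℝ ∞ (rootLadder r K k S R₀ j) :=
  ((contDiff_trapezoid r).comp (by fun_prop)).mul (contDiff_ladder _ _ _)

theorem mem_activeHeights_root (hr : 0 < r) {y : ℝ} (hy : trapezoid r (y - R₀.level) ≠ 0) :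
    y ∈ activeHeights r K 0 R₀ := by
  simp only [activeHeights, pow_zero, mul_one, mem_ofPred_eq]
  by_contra h
  exact hy (trapezoid_of_notMem hr h)

theorem abs_rootLadder_succ_sub_le (hr : 0 < r) (hq : 0 < q) (hrK : r * K = k) (hK : 3 < K)
    (hS : IsSelection K k q F S) (hR : R₀ ∈ F 0) (j : ℕ) (z : ℝ × ℝ) :
    |rootLadder r K k S R₀ (j + 1) z - rootLadder r K k S R₀ j z| ≤ (q⁻¹) ^ j := by
  rw [rootLadder, rootLadder, ← mul_sub, abs_mul, abs_of_nonneg (trapezoid_nonneg hr _)]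
  by_cases h0 : trapezoid r (z.2 - R₀.level) = 0
  · rw [h0, zero_mul]; positivity
  · exact (mul_le_of_le_one_left (abs_nonneg _) (trapezoid_le_one _ _)).trans
      (abs_ladder_succ_sub_le hr hq hrK hK hS hR j (mem_activeHeights_root hr h0))

theorem continuous_limitLadder (hr : 0 < r) (hq : 1 < q) (hrK : r * K = k) (hK : 3 < K)
    (hS : IsSelection K k q F S) (hR : R₀ ∈ F 0) : Continuous (limitLadder r K k S R₀) := by
  refine (contDiff_rootLadder 0).continuous.add (continuous_tsum (u := fun j => (q⁻¹) ^ j)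
    (fun j => (contDiff_rootLadder _).continuous.sub (contDiff_rootLadder _).continuous) ?_ ?_)
  · exact summable_geometric_of_lt_one (by positivity) (inv_lt_one_of_one_lt₀ hq)
  · exact fun j z => abs_rootLadder_succ_sub_le hr (by linarith) hrK hK hS hR j z

theorem limitLadder_eq_of_forall {z : ℝ × ℝ} {N : ℕ}
    (h : ∀ j, N ≤ j → rootLadder r K k S R₀ (j + 1) z = rootLadder r K k S R₀ j z) :
    limitLadder r K k S R₀ z = rootLadder r K k S R₀ N z := by
  rw [limitLadder, tsum_eq_sum (s := Finset.range N)]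
  · rw [Finset.sum_range_sub fun j => rootLadder r K k S R₀ j z]; ring
  · intro j hj
    exact sub_eq_zero.2 (h j (by simpa using hj))

/-- All refinements from depth `N` on change values only inside the boxes of scale `N`. Since those
boxes form a closed set, the limit is locally a smooth finite stage off the limit set. -/
theorem limitLadder_of_notMem (hr : 0 < r) (hq : 0 < q) (hrK : r * K = k) (hK : 3 < K)
    (hS : IsSelection K k q F S) (hR : R₀ ∈ F 0) {z : ℝ × ℝ} {N : ℕ}
    (hz : z ∉ extendedUnion r K F N) :
    limitLadder r K k S R₀ z = rootLadder r K k S R₀ N z := by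
  refine limitLadder_eq_of_forall fun j hj => ?_
  by_contra hne
  have h0 : trapezoid r (z.2 - R₀.level) ≠ 0 := fun h => hne (by simp [rootLadder, h])
  have hne' : ladder r K k S (j + 1) 0 R₀ z ≠ ladder r K k S j 0 R₀ z := fun h =>
    hne (by rw [rootLadder, rootLadder, h])
  have := mem_extendedUnion_of_ladder_ne hr hq hrK hK hS hR (mem_activeHeights_root hr h0) hne' hj
  rw [zero_add] at this
  exact hz this

theorem limitLadder_of_le_left (hS : IsSelection K k q F S) (hR : R₀ ∈ F 0) {z : ℝ × ℝ}
    (hz : z.1 ≤ R₀.left) : limitLadder r K k S R₀ z = 0 := by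
  have h : ∀ j, rootLadder r K k S R₀ j z = 0 := fun j => by
    rw [rootLadder, ladder_of_le_left hS hR j hz, mul_zero]
  rw [limitLadder_eq_of_forall (N := 0) fun j _ => by rw [h, h], h]

theorem limitLadder_of_right_le (hr : 0 < r) (hq : 0 < q) (hrK : r * K = k) (hK : 3 < K)
    (hS : IsSelection K k q F S) (hR : R₀ ∈ F 0) {z : ℝ × ℝ} (hz : R₀.right ≤ z.1) :
    limitLadder r K k S R₀ z = trapezoid r (z.2 - R₀.level) := by
  have h : ∀ j, rootLadder r K k S R₀ j z = trapezoid r (z.2 - R₀.level) := fun j => by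
    by_cases h0 : trapezoid r (z.2 - R₀.level) = 0
    · rw [rootLadder, h0, zero_mul]
    · rw [rootLadder, ladder_of_right_le hr hq hrK hK hS hR j hz (mem_activeHeights_root hr h0),
        mul_one]
  rw [limitLadder_eq_of_forall (N := 0) fun j _ => by rw [h, h], h]

theorem limitLadder_eq_zero_of_notMem (hr : 0 < r) {z : ℝ × ℝ}
    (hz : z.2 - R₀.level ∉ Icc (-(3 * r)) (1 - 2 * r)) : limitLadder r K k S R₀ z = 0 := by
  have h : ∀ j, rootLadder r K k S R₀ j z = 0 := fun j => by
    rw [rootLadder, trapezoid_of_notMem hr hz, zero_mul]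
  rw [limitLadder_eq_of_forall (N := 0) fun j _ => by rw [h, h], h]

theorem fderiv_rootLadder (j : ℕ) (z v : ℝ × ℝ) :
    fderiv ℝ (rootLadder r K k S R₀ j) z v =
      deriv (trapezoid r) (z.2 - R₀.level) * v.2 * ladder r K k S j 0 R₀ z +
        trapezoid r (z.2 - R₀.level) * fderiv ℝ (ladder r K k S j 0 R₀) z v := by
  have hd := (contDiff_trapezoid r).differentiable (by simp)
  have := fderiv_comp_snd_mul (g := fun y => trapezoid r (y - R₀.level)) (z := z) v
    (hd.comp (by fun_prop))
    ((contDiff_ladder (r := r) (K := K) (k := k) (S := S) j 0 R₀).differentiable (by simp) z)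
  rwa [deriv_comp_sub_const] at this

theorem fderiv_rootLadder_horizontal (hr : 0 < r) (hK : 0 < K) (hS : IsSelection K k q F S)
    (hR : R₀ ∈ F 0) {j : ℕ} {z : ℝ × ℝ} (hz : z ∉ extendedUnion r K F j) :
    fderiv ℝ (rootLadder r K k S R₀ j) z (1, 0) = 0 := by
  rw [fderiv_rootLadder]
  by_cases h0 : trapezoid r (z.2 - R₀.level) = 0
  · simp [h0]
  · have : fderiv ℝ (ladder r K k S j 0 R₀) z (1, 0) = 0 := by
      by_contra hne
      have := mem_extendedUnion_of_fderiv_ne hr hK hS hR (mem_activeHeights_root hr h0) hne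
        (le_refl j)
      rw [zero_add] at this
      exact hz this
    simp [this]

/-- The constant does not depend on the depth `j`: as `t < 1`, the geometric sum is dominated by the
last scale whose set contains `z`. The bounded part comes from the outer vertical cutoff. -/
theorem exists_abs_fderiv_rootLadder_vertical_le (hr : 0 < r) {t : ℝ} (ht0 : 0 < t) (ht1 : t < 1)
    (hrK : r * K = k) (hK : 3 < K) (hS : IsSelection K k (t * K) F S) (hR : R₀ ∈ F 0)
    {T : ℕ → Set (ℝ × ℝ)} (hT : ∀ n, extendedUnion r K F n ⊆ T n) :
    ∃ C : ℝ, 0 ≤ C ∧ ∀ j z, |fderiv ℝ (rootLadder r K k S R₀ j) z (0, 1)| ≤ C ∨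
      ∃ M, z ∈ T M ∧ |fderiv ℝ (rootLadder r K k S R₀ j) z (0, 1)| ≤ C * (t⁻¹) ^ M := by
  obtain ⟨D, hD⟩ := exists_abs_deriv_trapezoid_le hr
  have hD0 : 0 ≤ D := (abs_nonneg _).trans (hD 0)
  have h1t : 0 < 1 - t := by linarith
  set A : ℝ := (K + 2 * k : ℕ) * (D * K) with hA
  have hA0 : 0 ≤ A := by positivity
  refine ⟨D + A * (1 - t)⁻¹, by positivity, fun j z => ?_⟩
  have hbound : |fderiv ℝ (rootLadder r K k S R₀ j) z (0, 1)| ≤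
      D + A * ∑ i ∈ Finset.range j, (t⁻¹) ^ i * (T i).indicator 1 z := by
    rw [fderiv_rootLadder]
    refine (abs_add_le _ _).trans (add_le_add ?_ ?_)
    · have h := ladder_mem_Icc (K := K) (k := k) (S := S) hr j 0 R₀ z
      rw [mul_one, abs_mul, abs_of_nonneg h.1]
      exact (mul_le_of_le_one_right (abs_nonneg _) h.2).trans (hD _)
    · have hnn : 0 ≤ A * ∑ i ∈ Finset.range j, (t⁻¹) ^ i * (T i).indicator 1 z :=
        mul_nonneg hA0 (Finset.sum_nonneg fun i _ => mul_nonneg (by positivity)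
          (indicator_nonneg (fun _ _ => zero_le_one) _))
      by_cases h0 : trapezoid r (z.2 - R₀.level) = 0
      · rw [h0, zero_mul, abs_zero]; exact hnn
      · rw [abs_mul, abs_of_nonneg (trapezoid_nonneg hr _)]
        refine (mul_le_of_le_one_left (abs_nonneg _) (trapezoid_le_one _ _)).trans ?_
        have := abs_fderiv_ladder_vertical_le hr ht0 hrK hK hS hT hD hR j
          (mem_activeHeights_root hr h0)
        simpa only [pow_zero, mul_one, zero_add] using this
  rcases sum_geometric_indicator_le (T := T) ht0 ht1 z j with h | ⟨M, hM, h⟩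
  · refine Or.inl (hbound.trans ?_)
    rw [h, mul_zero, add_zero]
    exact le_add_of_nonneg_right (by positivity)
  · refine Or.inr ⟨M, hM, hbound.trans ?_⟩
    have h1 : 1 ≤ (t⁻¹) ^ M := one_le_pow₀ (one_le_inv_iff₀.2 ⟨ht0, ht1.le⟩)
    have h2 := mul_le_mul_of_nonneg_left h hA0
    have h3 := mul_le_mul_of_nonneg_left h1 hD0
    rw [add_mul, mul_assoc]
    linarith

end Limit

/-! ### Integrability of the vertical derivative and non-removability. -/

/-- A function that is at most `t⁻ᴹ` on the `M`-th of a sequence of sets whose measures decay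
faster than `t^(pM)`, and bounded elsewhere, is `p`-integrable. -/
theorem memLp_of_abs_le_geometric {α : Type*} [MeasurableSpace α] {μ : Measure α} {g : α → ℝ}
    {p t ρ A C : ℝ} (hp : 1 ≤ p) (ht : 0 < t) (hC : 0 ≤ C) (hρ : 0 ≤ ρ)
    (hlt : (t⁻¹) ^ p * ρ < 1)
    (hg : AEStronglyMeasurable g μ) {Q : Set α} (hQ : MeasurableSet Q) (hQμ : μ Q < ⊤)
    {T : ℕ → Set α} (hT : ∀ n, MeasurableSet (T n))
    (hTμ : ∀ n, μ (T n) ≤ ENNReal.ofReal (A * ρ ^ n))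
    (hbound : ∀ᵐ z ∂μ, g z = 0 ∨ (z ∈ Q ∧ |g z| ≤ C) ∨ ∃ M, z ∈ T M ∧ |g z| ≤ C * (t⁻¹) ^ M) :
    MemLp g (ENNReal.ofReal p) μ := by
  have hp0 : 0 < p := by linarith
  refine ⟨hg, ?_⟩
  rw [eLpNorm_lt_top_iff_lintegral_rpow_enorm_lt_top (by simpa using hp0) ENNReal.ofReal_ne_top,
    ENNReal.toReal_ofReal hp0.le]
  set a : ℕ → ℝ≥0∞ := fun i => ENNReal.ofReal (((t⁻¹) ^ p) ^ i) with ha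
  set G : α → ℝ≥0∞ := fun z => Q.indicator 1 z + ∑' i, a i * (T i).indicator 1 z with hG
  have hpt : ∀ᵐ z ∂μ, ‖g z‖ₑ ^ p ≤ ENNReal.ofReal (C ^ p) * G z := by
    filter_upwards [hbound] with z hz
    rw [Real.enorm_eq_ofReal_abs, ENNReal.ofReal_rpow_of_nonneg (abs_nonneg _) hp0.le]
    rcases hz with hz | ⟨hzQ, hz⟩ | ⟨M, hzM, hz⟩
    · simp [hz, Real.zero_rpow hp0.ne']
    · calc ENNReal.ofReal (|g z| ^ p) ≤ ENNReal.ofReal (C ^ p) * 1 := by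
            rw [mul_one]
            exact ENNReal.ofReal_le_ofReal (Real.rpow_le_rpow (abs_nonneg _) hz hp0.le)
        _ ≤ _ := by
            gcongr
            refine le_trans ?_ le_self_add
            rw [indicator_of_mem hzQ, Pi.one_apply]
    · calc ENNReal.ofReal (|g z| ^ p) ≤ ENNReal.ofReal (C ^ p) * a M := by
            rw [ha, ← ENNReal.ofReal_mul (by positivity), Real.rpow_pow_comm (by positivity),
              ← Real.mul_rpow hC (by positivity)]
            exact ENNReal.ofReal_le_ofReal (Real.rpow_le_rpow (abs_nonneg _) hz hp0.le)
        _ ≤ _ := by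
            gcongr
            refine le_trans ?_ le_add_self
            refine le_trans ?_ (ENNReal.le_tsum M)
            rw [indicator_of_mem hzM, Pi.one_apply, mul_one]
  refine (lintegral_mono_ae hpt).trans_lt ?_
  rw [lintegral_const_mul' _ _ ENNReal.ofReal_ne_top]
  refine ENNReal.mul_lt_top ENNReal.ofReal_lt_top ?_
  have hmeas : ∀ i, Measurable fun z => a i * (T i).indicator (1 : α → ℝ≥0∞) z := fun i =>
    (measurable_one.indicator (hT i)).const_mul _
  rw [hG, lintegral_add_left (measurable_one.indicator hQ), lintegral_indicator_one hQ,
    lintegral_tsum fun i => (hmeas i).aemeasurable]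
  refine ENNReal.add_lt_top.2 ⟨hQμ, ?_⟩
  have hterm : ∀ i, ∫⁻ z, a i * (T i).indicator 1 z ∂μ ≤
      ENNReal.ofReal (A * ((t⁻¹) ^ p * ρ) ^ i) := by
    intro i
    rw [lintegral_const_mul' _ _ ENNReal.ofReal_ne_top, lintegral_indicator_one (hT i)]
    refine (mul_le_mul_right (hTμ i) _).trans ?_
    rw [← ENNReal.ofReal_mul (by positivity)]
    exact ENNReal.ofReal_le_ofReal (le_of_eq (by rw [mul_pow]; ring))
  refine (ENNReal.tsum_le_tsum hterm).trans_lt ?_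
  exact ((summable_geometric_of_lt_one (by positivity) hlt).mul_left A).tsum_ofReal_lt_top

/-- The set `E` is left free so that both the graph and the limit set itself are covered. The
witness is the limit function times a horizontal cutoff. -/
theorem not_isW1pRemovable_of_isSelection {p t τ r : ℝ} (hp : 1 ≤ p) (ht0 : 0 < t) (ht1 : t < 1)
    (hτ : 0 < τ) (hr : 0 < r) (hr3 : 3 * r < 1) {B : ℝ → ℝ} (hB : ContinuousOn B (Icc 0 τ))
    {K k : ℕ} (hrK : r * K = k) (hK : 3 < K) (htK : (t⁻¹) ^ p < K) (hq : 1 < t * K)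
    {F : ℕ → Set PathBox} {S : ℕ → PathBox → ℕ → Finset PathBox}
    (hS : IsSelection K k (t * K) F S) (hR : rootBox τ ∈ F 0)
    (hT : ∀ n, extendedUnion r K F n ⊆ pathTube B τ K n)
    (hcl : ∀ n, IsClosed (extendedUnion r K F n)) {E : Set (ℝ × ℝ)} (hE : IsClosed E)
    (hE0 : volume E = 0) (hFE : familyLimitSet r K F ⊆ E) :
    ¬ IsW1pRemovable (ENNReal.ofReal p) E := by
  have hq0 : 0 < t * K := by linarith
  have hK0 : (0 : ℝ) < K := by exact_mod_cast (by omega : 0 < K)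
  set f := limitLadder r K k S (rootBox τ) with hf
  -- The cutoff `χ` makes the witness compactly supported, and `χ` is 1 near the support of `η`, so
  -- its derivative is invisible to the test function built from `η`.
  set χ := plateau (-2) (τ + 2) with hχ
  set η := plateau 0 τ with hη
  have hfc : Continuous f := continuous_limitLadder hr hq hrK hK hS hR
  have hχd : Differentiable ℝ χ := (contDiff_plateau _ _).differentiable (by simp)
  have hηd : Differentiable ℝ η := (contDiff_plateau _ _).differentiable (by simp)
  have hχ' : Continuous (deriv χ) := (contDiff_plateau _ _).continuous_deriv (by simp)
  have hlev : ∀ y : ℝ, y - ((rootBox τ).level : ℝ) = y := fun y => by simp [rootBox]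
  have hloc : ∀ z ∉ E, ∃ N, z ∉ extendedUnion r K F N ∧
      f =ᶠ[nhds z] rootLadder r K k S (rootBox τ) N := by
    intro z hz
    have : z ∉ familyLimitSet r K F := fun h => hz (hFE h)
    simp only [familyLimitSet, mem_iInter, not_forall] at this
    obtain ⟨N, hN⟩ := this
    refine ⟨N, hN, ?_⟩
    filter_upwards [(hcl N).isOpen_compl.mem_nhds hN] with w hw
    exact limitLadder_of_notMem hr hq0 hrK hK hS hR hw
  have hfd : ∀ z ∉ E, DifferentiableAt ℝ f z := by
    intro z hz
    obtain ⟨N, -, hN⟩ := hloc z hz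
    exact hN.symm.differentiableAt_iff.1 ((contDiff_rootLadder N).differentiable (by simp) z)
  have hfx : ∀ z ∉ E, fderiv ℝ f z (1, 0) = 0 := by
    intro z hz
    obtain ⟨N, hzN, hN⟩ := hloc z hz
    rw [hN.fderiv_eq]
    exact fderiv_rootLadder_horizontal hr (by omega) hS hR hzN
  have hzero : ∀ z : ℝ × ℝ, z ∉ Icc (-3) (τ + 3) ×ˢ Icc (-(3 * r)) (1 - 2 * r) →
      χ z.1 = 0 ∨ f z = 0 := by
    intro z hz
    by_cases h1 : z.1 ∈ Icc (-3) (τ + 3)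
    · refine Or.inr (limitLadder_eq_zero_of_notMem hr fun h2 => hz ⟨h1, ?_⟩)
      rwa [hlev] at h2
    · refine Or.inl (plateau_of_notMem fun h => h1 ⟨?_, ?_⟩) <;> linarith [h.1, h.2]
  have hsupp : HasCompactSupport fun z : ℝ × ℝ => χ z.1 * f z :=
    HasCompactSupport.intro (isCompact_Icc.prod isCompact_Icc) fun z hz => by
      rcases hzero z hz with h | h <;> simp [h]
  have hae : ∀ᵐ z : ℝ × ℝ, z ∉ E := compl_mem_ae_iff.2 hE0
  have hFx : ∀ z ∉ E, fderiv ℝ (fun w : ℝ × ℝ => χ w.1 * f w) z (1, 0) = deriv χ z.1 * f z := by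
    intro z hz
    rw [fderiv_comp_fst_mul _ hχd (hfd z hz), hfx z hz]
    simp
  have hFy : ∀ z ∉ E, fderiv ℝ (fun w : ℝ × ℝ => χ w.1 * f w) z (0, 1) =
      χ z.1 * fderiv ℝ f z (0, 1) := by
    intro z hz
    rw [fderiv_comp_fst_mul _ hχd (hfd z hz)]
    simp
  refine not_isW1pRemovable_of_classical_deriv (f := fun z => χ z.1 * f z)
    (ψ := fun z => η z.1 * trapezoid r z.2) (by simpa using hp) hE hE0
    ((hχd.continuous.comp continuous_fst).mul hfc) hsupp ?_ ?_ ?_ ?_ ?_ ?_ ?_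
  · exact fun z hz => (hχd.differentiableAt.comp z differentiableAt_fst).mul (hfd z hz)
  · have hcont : Continuous fun z : ℝ × ℝ => deriv χ z.1 * f z :=
      (hχ'.comp continuous_fst).mul hfc
    have hcs : HasCompactSupport fun z : ℝ × ℝ => deriv χ z.1 * f z := by
      refine HasCompactSupport.intro (K := Icc (-3) (τ + 3) ×ˢ Icc (-(3 * r)) (1 - 2 * r))
        (isCompact_Icc.prod isCompact_Icc) fun z hz => ?_
      by_cases h1 : z.1 ∈ Icc (-3) (τ + 3)
      · have : f z = 0 := limitLadder_eq_zero_of_notMem hr fun h2 => hz ⟨h1, by rwa [hlev] at h2⟩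
        rw [this, mul_zero]
      · rw [hχ, deriv_plateau_of_notMem, zero_mul]
        exact fun h => h1 ⟨by linarith [h.1], by linarith [h.2]⟩
    refine (hcont.memLp_of_hasCompactSupport hcs).ae_eq ?_
    filter_upwards [hae] with z hz
    exact (hFx z hz).symm
  · obtain ⟨C, hC, hCb⟩ := exists_abs_fderiv_rootLadder_vertical_le hr ht0 ht1 hrK hK hS hR hT
    refine memLp_of_abs_le_geometric (ρ := (K : ℝ)⁻¹) (A := 4 * τ) (t := t) (C := C)
      (Q := tsupport fun z : ℝ × ℝ => χ z.1 * f z) (T := pathTube B τ K) hp ht0 hC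
      (by positivity) ?_ ?_ (isClosed_tsupport _).measurableSet hsupp.isCompact.measure_lt_top
      (measurableSet_pathTube hB K) (fun n => ?_) ?_
    · rwa [← div_eq_mul_inv, div_lt_one hK0]
    · exact (measurable_fderiv_apply_const ℝ _ _).aestronglyMeasurable
    · refine (volume_pathTube_le hB K n).trans ?_
      rw [← ENNReal.ofReal_mul (by have := mesh_pos (by omega : 0 < K) n; positivity)]
      refine ENNReal.ofReal_le_ofReal (le_of_eq ?_)
      rw [mesh, inv_pow]; ring
    · filter_upwards [hae] with z hz
      by_cases hzQ : z ∈ tsupport fun z : ℝ × ℝ => χ z.1 * f z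
      swap
      · refine Or.inl ?_
        rw [image_eq_zero_of_notMem_tsupport (fun h => hzQ (tsupport_fderiv_subset ℝ h))]
        rfl
      obtain ⟨N, -, hN⟩ := hloc z hz
      have hle : |fderiv ℝ (fun w : ℝ × ℝ => χ w.1 * f w) z (0, 1)| ≤
          |fderiv ℝ (rootLadder r K k S (rootBox τ) N) z (0, 1)| := by
        rw [hFy z hz, hN.fderiv_eq, abs_mul]
        exact mul_le_of_le_one_left (abs_nonneg _) (abs_plateau_le_one _ _ _)
      rcases hCb N z with h | ⟨M, hM, h⟩
      · exact Or.inr (Or.inl ⟨hzQ, hle.trans h⟩)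
      · exact Or.inr (Or.inr ⟨M, hM, hle.trans h⟩)
  · exact ((contDiff_plateau _ _).comp contDiff_fst).mul ((contDiff_trapezoid r).comp contDiff_snd)
  · refine HasCompactSupport.intro (K := Icc (0 - 1) (τ + 1) ×ˢ Icc (-(3 * r)) (1 - 2 * r))
      (isCompact_Icc.prod isCompact_Icc) fun z hz => ?_
    by_cases h1 : z.1 ∈ Icc (0 - 1) (τ + 1)
    · rw [trapezoid_of_notMem hr fun h => hz ⟨h1, h⟩, mul_zero]
    · rw [hη, plateau_of_notMem h1, zero_mul]
  · intro z hz
    rw [hFx z hz]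
    by_cases h1 : z.1 ∈ Icc (0 - 1) (τ + 1)
    · rw [hχ, deriv_plateau_of_mem ⟨by linarith [h1.1], by linarith [h1.2]⟩, zero_mul, zero_mul]
    · rw [hη, plateau_of_notMem h1, zero_mul, mul_zero]
  -- Left of 0 the function `f` vanishes, on `[0, τ]` the derivative of `η` vanishes, and beyond `τ`
  -- the function `f` is the bump in the height. The integral thus factors as -1 times a positive
  -- number.
  · have hint : ∀ z : ℝ × ℝ, χ z.1 * f z *
        fderiv ℝ (fun w : ℝ × ℝ => η w.1 * trapezoid r w.2) z (1, 0) =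
        (Ioi τ).indicator (deriv η) z.1 * (trapezoid r z.2 * trapezoid r z.2) := by
      intro z
      have hd := (contDiff_trapezoid r).differentiable (by simp)
      have hsnd : fderiv ℝ (fun w : ℝ × ℝ => trapezoid r w.2) z (1, 0) = 0 := by
        have h : HasFDerivAt (fun w : ℝ × ℝ => trapezoid r w.2)
            (deriv (trapezoid r) z.2 • ContinuousLinearMap.snd ℝ ℝ ℝ) z :=
          (hd z.2).hasDerivAt.comp_hasFDerivAt z hasFDerivAt_snd
        rw [h.fderiv]
        simp
      rw [fderiv_comp_fst_mul (g := η) (f := fun w => trapezoid r w.2) _ hηd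
        ((hd z.2).comp z differentiableAt_snd), hsnd, mul_zero, add_zero]
      simp only [mul_one]
      by_cases h1 : z.1 ∈ Icc (0 - 1) (τ + 1)
      swap
      · have h0 : deriv η z.1 = 0 := deriv_plateau_of_notMem h1
        simp [indicator, h0]
      have hχ1 : χ z.1 = 1 := plateau_of_mem ⟨by linarith [h1.1], by linarith [h1.2]⟩
      rw [hχ1, one_mul]
      rcases le_or_gt z.1 0 with h | h
      · rw [hf, limitLadder_of_le_left hS hR h,
          indicator_of_notMem (fun h' => absurd (mem_Ioi.1 h') (by linarith))]
        ring
      rcases lt_or_ge τ z.1 with h' | h'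
      · rw [hf, limitLadder_of_right_le hr hq0 hrK hK hS hR h'.le, hlev,
          indicator_of_mem (mem_Ioi.2 h')]
        ring
      · have h0 : deriv η z.1 = 0 := by
          rcases h'.eq_or_lt with heq | hlt
          -- At the endpoint `τ` the cutoff attains its maximum 1.
          · refine IsLocalMax.deriv_eq_zero (Filter.Eventually.of_forall fun x => ?_)
            have : η z.1 = 1 := plateau_of_mem ⟨h.le, h'⟩
            rw [this]
            exact (le_abs_self _).trans (abs_plateau_le_one _ _ _)
          · exact deriv_plateau_of_mem ⟨h, hlt⟩
        simp [indicator, h0]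
    simp only [hint]
    rw [Measure.volume_eq_prod, integral_prod_mul (fun x => (Ioi τ).indicator (deriv η) x)
      (fun y => trapezoid r y * trapezoid r y), integral_indicator measurableSet_Ioi,
      integral_Ioi_deriv_plateau hτ.le]
    have hpos : 0 < ∫ y, trapezoid r y * trapezoid r y := by
      have hc := (contDiff_trapezoid r).continuous
      refine (hc.mul hc).integral_pos_of_hasCompactSupport_nonneg_nonzero (x := -(2 * r))
        (hasCompactSupport_trapezoid hr).mul_left (fun y => mul_self_nonneg _) ?_
      have : trapezoid r (-(2 * r)) = 1 := by
        rw [trapezoid, Real.smoothTransition.one_of_one_le, Real.smoothTransition.zero_of_nonpos,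
          sub_zero]
        · exact div_nonpos_of_nonpos_of_nonneg (by linarith) hr.le
        · rw [le_div_iff₀ hr]; linarith
      simp [this]
    linarith

/-! ### From nested families to selections, and the conclusion. -/

theorem IsNestedFamily.exists_isSelection {B : ℝ → ℝ} {τ r s t : ℝ} {K k : ℕ}
    {F : ℕ → Set PathBox} (hF : IsNestedFamily B τ K r s F) (hK : 0 < K) (hrK : r * K = k)
    (hts : t ≤ s) : ∃ S, IsSelection K k (t * K) F S := by
  have hm : ∀ i ∈ Finset.range (K + 2 * k), (i : ℤ) - 3 * k ∈ childHeights r K := by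
    intro i hi
    have h1 : (i : ℝ) + 1 ≤ K + 2 * k := by exact_mod_cast Finset.mem_range.1 hi
    have h0 : (0 : ℝ) ≤ i := by positivity
    constructor <;> push_cast
    · rw [mul_assoc, hrK]; linarith
    · rw [hrK]; linarith
  choose! S hc hS using hF.children
  have hbox : ∀ n, ∀ R ∈ F n, ∀ i ∈ Finset.range (K + 2 * k), ∀ R' ∈ S n R (i - 3 * k),
      IsChildAt B τ K n R R' (i - 3 * k) := fun n R hR i hi R' hR' =>
    (hS n R hR _ (hm i hi) R' hR').2
  refine ⟨fun n R i => S n R (i - 3 * k), ?_, ?_, ?_, ?_, ?_, ?_, ?_⟩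
  · exact fun n R hR => (hF.good n R hR).isBox.left_lt_right
  · exact fun n R hR i hi R' hR' => (hS n R hR _ (hm i hi) R' hR').1
  · exact fun n R hR i hi R' hR' => (hbox n R hR i hi R' hR').2.1
  · exact fun n R hR i hi R' hR' => (hbox n R hR i hi R' hR').2.2.1
  · exact fun n R hR i hi R' hR' => (hbox n R hR i hi R' hR').2.2.2
  · exact fun n R hR i hi => (mul_le_mul_of_nonneg_right hts (by positivity)).trans
      (hc n R hR _ (hm i hi))
  · exact fun n R hR i hi R₁ h₁ R₂ h₂ =>
      (hbox n R hR i hi R₁ h₁).1.eq_or_right_le_left hK (hbox n R hR i hi R₂ h₂).1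

/-- A path that stays above `-1` has a good root only if the boxes are extended by less than
their height. -/
theorem three_mul_lt_one_of_isInftyGood {B : ℝ → ℝ} {τ r s : ℝ} {K k : ℕ} (hs : 0 < s)
    (hK : 0 < K) (hrK : r * K = k) (hBlt : ∀ t ∈ Ico 0 τ, |B t| < 1)
    (h : IsInftyGood B τ K r s 0 (rootBox τ)) : 3 * r < 1 := by
  have hK' : (1 : ℝ) ≤ K := by exact_mod_cast hK
  have hk0 : (0 : ℝ) ≤ k := by positivity
  have hm : -(3 * (k : ℤ)) ∈ childHeights r K := by
    constructor <;> push_cast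
    · rw [mul_assoc, hrK]
    · rw [hrK]; linarith
  obtain ⟨N, hN, σ, ρ, hσ, -⟩ := (h 1 le_rfl).2 _ hm
  have hN0 : 0 < N := by
    have : (0 : ℝ) < N := lt_of_lt_of_le (by positivity) hN
    exact_mod_cast this
  -- An upcrossing at the lowest height starts at a value at most `-3 * r`, strictly before `τ`,
  -- where the path is still above -1.
  obtain ⟨h1, h2, h3, h4, -⟩ := hσ ⟨0, hN0⟩
  have h5 := hBlt _ ⟨h1, h2.trans_le h3⟩
  have h6 := mul_mesh_succ hK 0
  have h7 : -(3 * (k : ℝ)) * mesh K (0 + 1) = -(3 * r) := by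
    rw [← hrK]
    have : mesh K 0 = 1 := by simp [mesh]
    rw [this] at h6
    linear_combination (-(3 * r)) * h6
  simp only [rootBox, Int.cast_zero, zero_mul, zero_add] at h4
  push_cast at h4
  simp only [zero_add] at h7
  linarith [(abs_lt.1 h5).1]

/-- The geometric estimates need a ratio below 1, while `s` may be 1 or more; lowering it to `t`
only asks for fewer children. The last inequality follows from `t⁻¹ ≤ (t⁻¹) ^ p`, which uses `1 ≤
p`. -/
theorem exists_lt_one_of_rpow_neg_lt {p s x : ℝ} (hp : 1 ≤ p) (hs : 0 < s) (hx : 1 < x)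
    (h : s ^ (-p) < x) : ∃ t, 0 < t ∧ t < 1 ∧ t ≤ s ∧ (t⁻¹) ^ p < x ∧ 1 < t * x := by
  have hp0 : 0 < p := by linarith
  have key : ∃ t, 0 < t ∧ t < 1 ∧ t ≤ s ∧ (t⁻¹) ^ p < x := by
    rcases lt_or_ge s 1 with h1 | h1
    · refine ⟨s, hs, h1, le_rfl, ?_⟩
      rwa [Real.inv_rpow hs.le, ← Real.rpow_neg hs.le]
    · obtain ⟨y, hy1, hyx⟩ := exists_between hx
      have hy0 : 0 < y := by linarith
      refine ⟨(y ^ p⁻¹)⁻¹, by positivity, ?_, ?_, ?_⟩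
      · exact inv_lt_one_of_one_lt₀ (Real.one_lt_rpow hy1 (by positivity))
      · exact (inv_le_one_of_one_le₀ (Real.one_le_rpow hy1.le (by positivity))).trans h1
      · rwa [inv_inv, Real.rpow_inv_rpow hy0.le hp0.ne']
  obtain ⟨t, ht0, ht1, hts, ht⟩ := key
  refine ⟨t, ht0, ht1, hts, ht, ?_⟩
  have h1 : t⁻¹ ≤ (t⁻¹) ^ p := Real.self_le_rpow_of_one_le (one_le_inv_iff₀.2 ⟨ht0, ht1.le⟩) hp
  have h2 := mul_lt_mul_of_pos_left (h1.trans_lt ht) ht0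
  rwa [mul_inv_cancel₀ ht0.ne'] at h2

theorem proposition2p4 (p : ℝ) (hp : 1 ≤ p)
    -- a continuous path from `0` that hits `1` before `-1`, at time `τ`
    (B : ℝ → ℝ) (τ : ℝ) (hτ : 0 < τ) (hB : ContinuousOn B (Set.Icc 0 τ))
    (hB0 : B 0 = 0) (hBτ : B τ = 1) (hBlt : ∀ t ∈ Set.Ico 0 τ, |B t| < 1)
    -- the parameters, with `s = c / 2`
    (K : ℕ) (r c : ℝ) (hr : 0 < r) (hc : 0 < c) (hrK : ∃ k : ℕ, r * K = k)
    (hK : (c / 2) ^ (-p) < (K : ℝ))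
    (hgood : IsInftyGood B τ K r (c / 2) 0 (rootBox τ)) :
    (IsCompact (pathGraph B τ) ∧ ¬ IsW1pRemovable (ENNReal.ofReal p) (pathGraph B τ)) ∧
    (∃ F : ℕ → Set PathBox, IsNestedFamily B τ K r (c / 2) F) ∧
    ∀ F : ℕ → Set PathBox, IsNestedFamily B τ K r (c / 2) F →
      familyLimitSet r K F ⊆ pathGraph B τ ∧ IsCompact (familyLimitSet r K F) ∧
        ¬ IsW1pRemovable (ENNReal.ofReal p) (familyLimitSet r K F) := by
  have hs : 0 < c / 2 := by positivity
  obtain ⟨k, hrK⟩ := hrK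
  have hK0 : 0 < K := by
    have : (0 : ℝ) < K := (Real.rpow_pos_of_pos hs _).trans hK
    exact_mod_cast this
  have hK0' : (0 : ℝ) < K := by exact_mod_cast hK0
  have hr3 := three_mul_lt_one_of_isInftyGood hs hK0 hrK hBlt hgood
  have hK3 : 3 < K := by
    have hk : (1 : ℝ) ≤ k := by
      have : (0 : ℝ) < k := hrK ▸ mul_pos hr hK0'
      exact_mod_cast this
    -- From `3 * r < 1` and `r * K = k ≥ 1` one gets `3 ≤ 3 * r * K < K`.
    have : (3 : ℝ) < K := by nlinarith
    exact_mod_cast this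
  obtain ⟨t, ht0, ht1, hts, htK, hq⟩ :=
    exists_lt_one_of_rpow_neg_lt hp hs (by exact_mod_cast (by omega : 1 < K)) hK
  have hmain : ∀ F, IsNestedFamily B τ K r (c / 2) F → ∀ E, IsClosed E → volume E = 0 →
      familyLimitSet r K F ⊆ E → ¬ IsW1pRemovable (ENNReal.ofReal p) E := by
    intro F hF E hE hE0 hFE
    obtain ⟨S, hS⟩ := hF.exists_isSelection hK0 hrK hts
    refine not_isW1pRemovable_of_isSelection hp ht0 ht1 hτ hr hr3 hB hrK hK3 htK hq hS
      (by rw [hF.root]; rfl) (fun n z hz => ?_)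
      (fun n => (isCompact_extendedUnion hB hK0 hF n).isClosed) hE hE0 hFE
    obtain ⟨R, hR, hzR⟩ := mem_iUnion₂.1 hz
    exact (hF.good n R hR).isBox.abs_sub_le_of_mem_extended hB hK0 hr3.le hzR
  have hsub : ∀ F, IsNestedFamily B τ K r (c / 2) F → familyLimitSet r K F ⊆ pathGraph B τ :=
    fun F hF => familyLimitSet_subset_pathGraph hB (by omega) hr3.le hF
  have hex := isNestedFamily_goodDescendants hB hK0 hgood
  refine ⟨⟨isCompact_pathGraph hB, ?_⟩, ⟨_, hex⟩, fun F hF => ⟨hsub F hF, ?_, ?_⟩⟩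
  · exact hmain _ hex _ (isCompact_pathGraph hB).isClosed (volume_pathGraph hB) (hsub _ hex)
  · exact isCompact_familyLimitSet hB hK0 hF
  · exact hmain F hF _ (isCompact_familyLimitSet hB hK0 hF).isClosed
      (measure_mono_null (hsub F hF) (volume_pathGraph hB)) subset_rfl
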